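/- **Setting.** Let $X$ be a metric space in which every closed ball can be covered by at most $2^d$ closed balls of half its radius (doubling dimension at most $d$, where $d\ge 0$ is a fixed real constant). Let $k\ge 1$, $z\ge 0$ be integers. For a finite multiset $Q$ of points of $X$, a *valid solution* of cost $r\ge 0$ consists of at most $k$ closed balls of radius $r$, centered at points of $X$, that together cover all points of $Q$ except at most $z$ outliers (counted with multiplicity), and $\mathrm{opt}_{k,z}(Q)$ is the infimum of the costs of the valid solutions for $Q$. Points from $X$ arrive in a possibly infinite stream, finitely many up to any time (repetitions are allowed). A point that arrives at time $t_{\rm arr}$ expires (departs) at time $t_{\rm arr}+W$, where $W>0$ is the given window length; $P(t)$ is the multiset of points with $t_{\rm arr}\le t<t_{\rm arr}+W$. All arrival and departure times are distinct. Numbers $0<\Delta_{\min}\le\Delta_{\max}$ are given such that any two distinct points of the stream have distance between $\Delta_{\min}$ and $\Delta_{\max}$, and $\sigma:=\Delta_{\max}/\Delta_{\min}$. The computational model is a real RAM in which a point occupies one cell, points can only be copied, and the distance between two given points is computed in one step. **Theorem.** Suppose we have a $c$-approximation algorithm, $c\ge 1$, for the static problem on $X$: on any $n$ points it reports, in at most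 $T_{k,z}(n)$ time, a valid solution of cost at most $c$ times the optimum. It is used as a subroutine that is handed a regularly spaced sequence of memory cells containing its input points. Then for any $0<\varepsilon<1$ a sketch of the stream can be maintained with the following properties, where the constants hidden in the $O$-notation depend only on $d$, and the algorithm is one fixed program that is given $k,z,\varepsilon,W,\Delta_{\min},\Delta_{\max}$. 1. The sketch uses $O\big(\frac{k(z+1)}{\varepsilon^d}(1+\log\sigma)\big)$ storage. 2. Every departure is handled in $O(1+\log\sigma)$ time and every arrival in $O\big(\big(\frac{k(z+1)}{\varepsilon^d}\big)^3(1+\log\sigma)\big)$ time. 3. At any time $t$ the algorithm can report a valid solution for $P(t)$ of cost at most $(1+\varepsilon)\,c\cdot\mathrm{opt}_{k,z}(P(t))$, without changing the sketch, in time $T_{k,z}(m)+O(1)$ for some $m=O\big(\frac{k(z+1)}{\varepsilon^d}\big)$. -/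

import Mathlib

universe u

/-! ## The `k`-center problem with outliers -/

/-- The closed balls of radius `r` around the points of `C` form a valid solution for the multiset
`Q`: there are at most `k` balls, and at most `z` points of `Q` (counted with multiplicity) lie
outside all of them. The cost of the solution is `r`. The centers may be any points of `X`. -/
def IsSolution {X : Type u} [MetricSpace X] (k z : ℕ) (Q : Multiset X) (C : List X) (r : ℝ) :
    Prop :=
  0 ≤ r ∧ C.length ≤ k ∧
    ∃ O R : Multiset X, Q = O + R ∧ O.card ≤ z ∧ ∀ q ∈ R, ∃ c ∈ C, dist q c ≤ r

/-- The optimal cost. It is an infimum because in a general metric space a smallest radius need not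
exist; the infimum is taken over a nonempty set bounded below by `0` if `1 ≤ k`. -/
noncomputable def opt {X : Type u} [MetricSpace X] (k z : ℕ) (Q : Multiset X) : ℝ :=
  sInf {r : ℝ | ∃ C : List X, IsSolution k z Q C r}

/-- The doubling dimension of `X` is at most `d`: every closed ball can be covered by at most `2 ^ d`
closed balls of half its radius. -/
def DoublingDimLE (X : Type u) [MetricSpace X] (d : ℝ) : Prop :=
  ∀ (x : X) (r : ℝ), 0 < r → ∃ s : Finset X, (s.card : ℝ) ≤ 2 ^ d ∧
    Metric.closedBall x r ⊆ ⋃ y ∈ s, Metric.closedBall y (r / 2)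

/-- An algorithm for the static problem on `X`: for every finite sequence of points the centers and
the radius that it reports, and the number of steps that it takes. -/
structure StaticAlg (X : Type u) where
  centers : List X → List X
  radius : List X → ℝ
  time : List X → ℕ

/-- The static algorithm is a `c`-approximation algorithm. -/
def StaticAlg.IsApprox {X : Type u} [MetricSpace X] (alg : StaticAlg X) (k z : ℕ) (c : ℝ) : Prop :=
  ∀ Q : List X, IsSolution k z (Q : Multiset X) (alg.centers Q) (alg.radius Q) ∧
    alg.radius Q ≤ c * opt k z (Q : Multiset X)

/-- The static algorithm takes at most `T n` steps on any `n` points. -/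
def StaticAlg.RunsIn {X : Type u} (alg : StaticAlg X) (T : ℕ → ℝ) : Prop :=
  ∀ Q : List X, (alg.time Q : ℝ) ≤ T Q.length

/-! ## Streams and sliding windows -/

/-- A possibly infinite stream of points with their arrival times. Only finitely many points have
arrived at any time. The same point of `X` may occur several times. -/
structure PointStream (X : Type u) where
  ι : Type
  pt : ι → X
  arr : ι → ℝ
  finite_arr : ∀ t : ℝ, {i | arr i ≤ t}.Finite

namespace PointStream

variable {X : Type u}

/-- The multiset `P(t)` of points in a window of length `W`, that is, of the points that have
arrived at time `t` and have not yet expired. -/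
noncomputable def window (S : PointStream X) (W t : ℝ) : Multiset X :=
  ((S.finite_arr t).subset
    (fun _ h => h.1 : {i | S.arr i ≤ t ∧ t < S.arr i + W} ⊆ {i | S.arr i ≤ t})).toFinset.val.map S.pt

/-- All arrival times and departure times are distinct. -/
def DistinctTimes (S : PointStream X) (W : ℝ) : Prop :=
  Function.Injective S.arr ∧ ∀ i j, S.arr i ≠ S.arr j + W

/-- `Δmin` and `Δmax` are bounds on the distances between distinct points of the stream. -/
def DistBounds [MetricSpace X] (S : PointStream X) (Δmin Δmax : ℝ) : Prop :=
  ∀ i j, S.pt i ≠ S.pt j → Δmin ≤ dist (S.pt i) (S.pt j) ∧ dist (S.pt i) (S.pt j) ≤ Δmax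

/-- The times at which a point arrives or departs. -/
def events (S : PointStream X) (W : ℝ) : Set ℝ :=
  {t | ∃ i, t = S.arr i ∨ t = S.arr i + W}

end PointStream

/-! ## The machine model

A random access machine with three sorts of cells, each of which holds a natural number, a real
number, or a point of the metric space (or is empty). Natural numbers can be added, subtracted and
compared, real numbers can also be multiplied and divided, and the distance between two points is
obtained in one step. Points can only be copied and compared through their distances. -/

/-- The part of the memory that is kept: for each sort, arrays of cells; `nat a i` is the cell with
index `i` in the array `a`. -/
structure Memory (X : Type u) where
  nat : ℕ → ℕ → ℕ
  real : ℕ → ℕ → ℝ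
  pt : ℕ → ℕ → Option X

/-- The blank memory. -/
def Memory.blank {X : Type u} : Memory X := ⟨fun _ _ => 0, fun _ _ => 0, fun _ _ => none⟩

/-- The state during a computation: the memory, the registers (which a program names explicitly, so
that it uses a fixed number of them), and the centers reported by the static algorithm. -/
structure State (X : Type u) where
  mem : Memory X
  nreg : ℕ → ℕ
  rreg : ℕ → ℝ
  preg : ℕ → Option X
  out : List X

/-- Expressions for natural numbers; `load a i` reads cell `i` of array `a`. -/
inductive NExp where
  | lit (n : ℕ)
  | reg (x : ℕ)
  | load (a : ℕ) (i : NExp)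
  | add (e f : NExp)
  | sub (e f : NExp)

/-- Expressions for points. -/
inductive PExp where
  | reg (x : ℕ)
  | load (a : ℕ) (i : NExp)

/-- Expressions for real numbers. -/
inductive RExp where
  | lit (q : ℚ)
  | reg (x : ℕ)
  | load (a : ℕ) (i : NExp)
  | add (e f : RExp)
  | sub (e f : RExp)
  | mul (e f : RExp)
  | div (e f : RExp)
  | dist (p q : PExp)

/-- Tests. -/
inductive BExp where
  | nle (e f : NExp)
  | rle (e f : RExp)
  | not (b : BExp)
  | and (b c : BExp)

/-- Programs. The command `call base stride len x` runs the static algorithm on the `len` points in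
the cells `base`, `base + stride`, `base + 2 * stride`, ... of the point array `a`; the reported
centers are put out and the reported radius is put into the real register `x`. -/
inductive Prog where
  | skip
  | setN (x : ℕ) (e : NExp)
  | setR (x : ℕ) (e : RExp)
  | setP (x : ℕ) (e : PExp)
  | storeN (a : ℕ) (i : NExp) (e : NExp)
  | storeR (a : ℕ) (i : NExp) (e : RExp)
  | storeP (a : ℕ) (i : NExp) (e : PExp)
  | seq (p q : Prog)
  | ite (b : BExp) (p q : Prog)
  | loop (b : BExp) (p : Prog)
  | call (a : ℕ) (base stride len : NExp) (x : ℕ)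

/-- The number of operations needed to evaluate an expression. -/
def NExp.cost : NExp → ℕ
  | lit _ => 1
  | reg _ => 1
  | load _ i => i.cost + 1
  | add e f => e.cost + f.cost + 1
  | sub e f => e.cost + f.cost + 1

/-- The number of operations needed to evaluate an expression. -/
def PExp.cost : PExp → ℕ
  | reg _ => 1
  | load _ i => i.cost + 1

/-- The number of operations needed to evaluate an expression. -/
def RExp.cost : RExp → ℕ
  | lit _ => 1
  | reg _ => 1
  | load _ i => i.cost + 1
  | add e f => e.cost + f.cost + 1
  | sub e f => e.cost + f.cost + 1
  | mul e f => e.cost + f.cost + 1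
  | div e f => e.cost + f.cost + 1
  | dist p q => p.cost + q.cost + 1

/-- The number of operations needed to evaluate an expression. -/
def BExp.cost : BExp → ℕ
  | nle e f => e.cost + f.cost + 1
  | rle e f => e.cost + f.cost + 1
  | not b => b.cost + 1
  | and b c => b.cost + c.cost + 1

section Semantics

variable {X : Type u}

/-- The value of an expression; subtraction of natural numbers is truncated. -/
def NExp.val (s : State X) : NExp → ℕ
  | lit n => n
  | reg x => s.nreg x
  | load a i => s.mem.nat a (i.val s)
  | add e f => e.val s + f.val s
  | sub e f => e.val s - f.val s

/-- The value of a point expression; it is `none` if an empty cell is read. -/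
def PExp.val (s : State X) : PExp → Option X
  | reg x => s.preg x
  | load a i => s.mem.pt a (i.val s)

/-- The distance between the contents of two point cells, and `0` if one of them is empty. -/
noncomputable def cellDist [MetricSpace X] : Option X → Option X → ℝ
  | some x, some y => Dist.dist x y
  | _, _ => 0

/-- The value of a real expression; division by zero yields `0`. -/
noncomputable def RExp.val [MetricSpace X] (s : State X) : RExp → ℝ
  | lit q => (q : ℝ)
  | reg x => s.rreg x
  | load a i => s.mem.real a (i.val s)
  | add e f => e.val s + f.val s
  | sub e f => e.val s - f.val s
  | mul e f => e.val s * f.val s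
  | div e f => e.val s / f.val s
  | dist p q => cellDist (p.val s) (q.val s)

/-- The truth of a test. -/
def BExp.val [MetricSpace X] (s : State X) : BExp → Prop
  | nle e f => e.val s ≤ f.val s
  | rle e f => e.val s ≤ f.val s
  | not b => ¬ b.val s
  | and b c => b.val s ∧ c.val s

/-- Replace the content of cell `i` of array `a`. -/
def setCell {β : Type*} (m : ℕ → ℕ → β) (a i : ℕ) (v : β) : ℕ → ℕ → β :=
  Function.update m a (Function.update (m a) i v)

/-- The points in the nonempty cells among `base`, `base + stride`, ... (`len` cells). -/
def cellRange (m : ℕ → Option X) (base stride len : ℕ) : List X :=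
  (List.range len).filterMap fun j => m (base + j * stride)

/-- `Exec alg A M p s n s'`: on a machine whose memory consists, for each of the three sorts, of `A`
arrays of `M` cells each, the program `p` when started in the state `s` halts after `n` steps in
the state `s'`. There is no rule for a write access outside the memory: such a computation fails.
(Cells outside the memory thus remain blank for ever.) -/
inductive Exec [MetricSpace X] (alg : StaticAlg X) (A M : ℕ) :
    Prog → State X → ℕ → State X → Prop
  | skip (s : State X) : Exec alg A M .skip s 1 s
  | setN (s : State X) (x : ℕ) (e : NExp) :
      Exec alg A M (.setN x e) s (e.cost + 1)
        { s with nreg := Function.update s.nreg x (e.val s) }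
  | setR (s : State X) (x : ℕ) (e : RExp) :
      Exec alg A M (.setR x e) s (e.cost + 1)
        { s with rreg := Function.update s.rreg x (e.val s) }
  | setP (s : State X) (x : ℕ) (e : PExp) :
      Exec alg A M (.setP x e) s (e.cost + 1)
        { s with preg := Function.update s.preg x (e.val s) }
  | storeN (s : State X) (a : ℕ) (i e : NExp) (ha : a < A) (hi : i.val s < M) :
      Exec alg A M (.storeN a i e) s (i.cost + e.cost + 1)
        { s with mem := { s.mem with nat := setCell s.mem.nat a (i.val s) (e.val s) } }
  | storeR (s : State X) (a : ℕ) (i : NExp) (e : RExp) (ha : a < A) (hi : i.val s < M) :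
      Exec alg A M (.storeR a i e) s (i.cost + e.cost + 1)
        { s with mem := { s.mem with real := setCell s.mem.real a (i.val s) (e.val s) } }
  | storeP (s : State X) (a : ℕ) (i : NExp) (e : PExp) (ha : a < A) (hi : i.val s < M) :
      Exec alg A M (.storeP a i e) s (i.cost + e.cost + 1)
        { s with mem := { s.mem with pt := setCell s.mem.pt a (i.val s) (e.val s) } }
  | seq {p q : Prog} {s s₁ s₂ : State X} {n₁ n₂ : ℕ}
      (hp : Exec alg A M p s n₁ s₁) (hq : Exec alg A M q s₁ n₂ s₂) :
      Exec alg A M (.seq p q) s (n₁ + n₂) s₂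
  | iteTrue {b : BExp} {p : Prog} (q : Prog) {s s₁ : State X} {n : ℕ}
      (hb : b.val s) (hp : Exec alg A M p s n s₁) :
      Exec alg A M (.ite b p q) s (b.cost + 1 + n) s₁
  | iteFalse {b : BExp} (p : Prog) {q : Prog} {s s₁ : State X} {n : ℕ}
      (hb : ¬ b.val s) (hq : Exec alg A M q s n s₁) :
      Exec alg A M (.ite b p q) s (b.cost + 1 + n) s₁
  | loopFalse {b : BExp} (p : Prog) {s : State X} (hb : ¬ b.val s) :
      Exec alg A M (.loop b p) s (b.cost + 1) s
  | loopTrue {b : BExp} {p : Prog} {s s₁ s₂ : State X} {n₁ n₂ : ℕ}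
      (hb : b.val s) (hp : Exec alg A M p s n₁ s₁) (hl : Exec alg A M (.loop b p) s₁ n₂ s₂) :
      Exec alg A M (.loop b p) s (b.cost + 1 + n₁ + n₂) s₂
  | call (s : State X) (a : ℕ) (base stride len : NExp) (x : ℕ) (L : List X)
      (hL : L = cellRange (s.mem.pt a) (base.val s) (stride.val s) (len.val s)) :
      Exec alg A M (.call a base stride len x) s
        (base.cost + stride.cost + len.cost + 1 + alg.time L)
        { s with rreg := Function.update s.rreg x (alg.radius L), out := alg.centers L }

end Semantics

/-! ## Sketching algorithms in the sliding-window model -/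

/-- The parameters of the problem that are known to the algorithm. -/
structure Params where
  k : ℕ
  z : ℕ
  ε : ℝ
  W : ℝ
  Δmin : ℝ
  Δmax : ℝ

/-- A sketching algorithm: the programs that handle the arrival of a point, handle the departure of
a point, and report a solution. -/
structure SketchAlg where
  arrive : Prog
  depart : Prog
  report : Prog

/-- The state in which a program is started at time `t`: only the memory is kept from before, and
the registers hold the parameters, the time, and the arriving point if there is one. -/
noncomputable def startState {X : Type u} (π : Params) (m : Memory X) (t : ℝ) (p : Option X) :
    State X where
  mem := m
  nreg := fun x => if x = 0 then π.k else if x = 1 then π.z else 0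
  rreg := fun x => if x = 0 then t else if x = 1 then π.W else if x = 2 then π.ε
    else if x = 3 then π.Δmin else if x = 4 then π.Δmax else 0
  preg := fun x => if x = 0 then p else none
  out := []

/-- `mem t` is the content of the memory at time `t` (after the event at time `t`, if there is one)
when the sketching algorithm is run on the stream `S` on a machine with `A` arrays of `M` cells of
each sort. Each arrival is handled in at most `tArr` steps, each departure in at most `tDep` steps.
The memory is blank before the first arrival and only changes at the events. -/
structure IsRun {X : Type u} [MetricSpace X] (alg : StaticAlg X) (A M : ℕ) (G : SketchAlg)
    (π : Params) (S : PointStream X) (tArr tDep : ℝ) (mem : ℝ → Memory X) : Prop where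
  blank : ∀ t, (∀ i, t < S.arr i) → mem t = Memory.blank
  idle : ∀ t t', t ≤ t' → (∀ u ∈ S.events π.W, ¬ (t < u ∧ u ≤ t')) → mem t' = mem t
  arrive : ∀ i t, t < S.arr i → (∀ u ∈ S.events π.W, ¬ (t < u ∧ u < S.arr i)) →
    ∃ (n : ℕ) (s : State X),
      Exec alg A M G.arrive (startState π (mem t) (S.arr i) (some (S.pt i))) n s ∧
      s.mem = mem (S.arr i) ∧ (n : ℝ) ≤ tArr
  depart : ∀ i t, t < S.arr i + π.W → (∀ u ∈ S.events π.W, ¬ (t < u ∧ u < S.arr i + π.W)) →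
    ∃ (n : ℕ) (s : State X),
      Exec alg A M G.depart (startState π (mem t) (S.arr i + π.W) none) n s ∧
      s.mem = mem (S.arr i + π.W) ∧ (n : ℝ) ≤ tDep

/-- Started on the memory content `m` at time `t`, the sketching algorithm reports the balls of
radius `r` around the points of `C` in `n` steps, and leaves the memory as it was. -/
def Reports {X : Type u} [MetricSpace X] (alg : StaticAlg X) (A M : ℕ) (G : SketchAlg)
    (π : Params) (m : Memory X) (t : ℝ) (C : List X) (r : ℝ) (n : ℕ) : Prop :=
  ∃ s : State X, Exec alg A M G.report (startState π m t none) n s ∧ s.mem = m ∧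
    s.out = C ∧ s.rreg 0 = r

/-! The sketch keeps `n` independent levels. Level `i` works with a radius `δ`, namely
`levelRadius`, and a scale `ρ = 2 ^ i * Δmin / 2`. For `i ≥ 1` these satisfy `δ = ε * ρ / 4`; at
level `0` the radius is `0`. A level stores active points in order of arrival, each with a center at
distance at most `δ`. Distinct centers are more than `δ` apart, and each center has at most `z + 1`
stored points. A center is a copied point, so it may outlive the stream point it came from.

An arriving point joins a center within distance `δ`, or becomes a center itself. If its group
already has `z + 1` members, the oldest member is dropped. If instead the level holds `cap = k * N *
(z + 1) + z` points, the oldest entry of the whole level is dropped and its expiration time `e` is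
recorded. The level counts as valid once `e` has passed.

Two facts carry the proof.

A valid level is a coreset (`LevelInv.coreset`). An active point that is not stored has `z + 1`
newer stored points in a group whose center is within `δ` of it. At most `z` of them are outliers,
so some ball contains one of them, and enlarging the balls by `2 * δ` covers the missing point
(`IsSolution.extend`). Counting only newer points makes this property survive departures.

An invalid level certifies `ρ ≤ opt` (`LevelInv.le_opt`). When the entry expiring at `e` was
dropped, there were `cap + 1` points, none expiring before `e`, so all of them are still in the
window. If `k` balls of radius `r < ρ` left out only `z` of them, then by packing each ball would
meet at most `N` groups of at most `z + 1` points, which is too few (`le_opt_of_length_lt`).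

The first valid level is reported. If it is level `0`, nothing is lost. If it is level `i + 1`, then
level `i` is invalid, and the extra radius `2 * δ` is exactly `ε` times the scale of level `i`, so
it is at most `ε * opt`. The scale of the last level exceeds `Δmax ≥ opt`, so that level is always
valid (`exists_valid`).

Validity and the window change only at events, so the choice of level is stored at each event and
reporting needs one call. The rest shows that explicit programs carry this out: a
weakest-precondition calculus treats straight-line code, `Runs.loop` treats loops, and `exists_run`
strings the events together. -/

namespace SlidingKCenter

/-! ## Symbolic execution -/

section Machine

variable {X : Type u}

/-- The registers used by the sketching algorithm. -/
structure Regs (X : Type u) where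
  k : ℕ
  z : ℕ
  num : ℕ
  cap : ℕ
  lvl : ℕ
  base : ℕ
  src : ℕ
  dst : ℕ
  cnt : ℕ
  mode : ℕ
  last : ℕ
  time : ℝ
  W : ℝ
  ε : ℝ
  Δmin : ℝ
  Δmax : ℝ
  scale : ℝ
  δ : ℝ
  pow : ℝ
  p : Option X
  c : Option X

namespace Regs

/-- The registers that hold natural numbers. -/
def nat (R : Regs X) : ℕ → ℕ
  | 0 => R.k
  | 1 => R.z
  | 2 => R.num
  | 3 => R.cap
  | 4 => R.lvl
  | 5 => R.base
  | 6 => R.src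
  | 7 => R.dst
  | 8 => R.cnt
  | 9 => R.mode
  | 10 => R.last
  | _ => 0

/-- The registers that hold real numbers. -/
def real (R : Regs X) : ℕ → ℝ
  | 0 => R.time
  | 1 => R.W
  | 2 => R.ε
  | 3 => R.Δmin
  | 4 => R.Δmax
  | 5 => R.scale
  | 6 => R.δ
  | 7 => R.pow
  | _ => 0

/-- The registers that hold points. -/
def pt (R : Regs X) : ℕ → Option X
  | 0 => R.p
  | 1 => R.c
  | _ => none

/-- Assignment to a natural number register. -/
def setNat (R : Regs X) (x v : ℕ) : Regs X :=
  match x with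
  | 0 => { R with k := v }
  | 1 => { R with z := v }
  | 2 => { R with num := v }
  | 3 => { R with cap := v }
  | 4 => { R with lvl := v }
  | 5 => { R with base := v }
  | 6 => { R with src := v }
  | 7 => { R with dst := v }
  | 8 => { R with cnt := v }
  | 9 => { R with mode := v }
  | 10 => { R with last := v }
  | _ => R

/-- Assignment to a real register. -/
def setReal (R : Regs X) (x : ℕ) (v : ℝ) : Regs X :=
  match x with
  | 0 => { R with time := v }
  | 1 => { R with W := v }
  | 2 => { R with ε := v }
  | 3 => { R with Δmin := v }
  | 4 => { R with Δmax := v }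
  | 5 => { R with scale := v }
  | 6 => { R with δ := v }
  | 7 => { R with pow := v }
  | _ => R

/-- Assignment to a point register. -/
def setPt (R : Regs X) (x : ℕ) (v : Option X) : Regs X :=
  match x with
  | 0 => { R with p := v }
  | 1 => { R with c := v }
  | _ => R

/-- The machine state with given registers and memory. -/
def state (R : Regs X) (m : Memory X) : State X where
  mem := m
  nreg := R.nat
  rreg := R.real
  preg := R.pt
  out := []

theorem nat_setNat (R : Regs X) {x : ℕ} (hx : x < 11) (v : ℕ) :
    (R.setNat x v).nat = Function.update R.nat x v := by
  funext y
  rw [Function.update_apply]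
  interval_cases x <;> rcases y with _|_|_|_|_|_|_|_|_|_|_|y <;> simp [setNat, nat]

theorem real_setReal (R : Regs X) {x : ℕ} (hx : x < 8) (v : ℝ) :
    (R.setReal x v).real = Function.update R.real x v := by
  funext y
  rw [Function.update_apply]
  interval_cases x <;> rcases y with _|_|_|_|_|_|_|_|y <;> simp [setReal, real]

theorem pt_setPt (R : Regs X) {x : ℕ} (hx : x < 2) (v : Option X) :
    (R.setPt x v).pt = Function.update R.pt x v := by
  funext y
  rw [Function.update_apply]
  interval_cases x <;> rcases y with _|_|y <;> simp [setPt, pt]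

theorem state_setNat (R : Regs X) (m : Memory X) {x : ℕ} (hx : x < 11) (v : ℕ) :
    (R.setNat x v).state m =
      { R.state m with nreg := Function.update (R.state m).nreg x v } := by
  have h1 : (R.setNat x v).real = R.real := by
    funext y; unfold setNat; split <;> rfl
  have h2 : (R.setNat x v).pt = R.pt := by
    funext y; unfold setNat; split <;> rfl
  simp [state, nat_setNat R hx, h1, h2]

theorem state_setReal (R : Regs X) (m : Memory X) {x : ℕ} (hx : x < 8) (v : ℝ) :
    (R.setReal x v).state m =
      { R.state m with rreg := Function.update (R.state m).rreg x v } := by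
  have h1 : (R.setReal x v).nat = R.nat := by
    funext y; unfold setReal; split <;> rfl
  have h2 : (R.setReal x v).pt = R.pt := by
    funext y; unfold setReal; split <;> rfl
  simp [state, real_setReal R hx, h1, h2]

theorem state_setPt (R : Regs X) (m : Memory X) {x : ℕ} (hx : x < 2) (v : Option X) :
    (R.setPt x v).state m =
      { R.state m with preg := Function.update (R.state m).preg x v } := by
  have h1 : (R.setPt x v).nat = R.nat := by
    funext y; unfold setPt; split <;> rfl
  have h2 : (R.setPt x v).real = R.real := by
    funext y; unfold setPt; split <;> rfl
  simp [state, pt_setPt R hx, h1, h2]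

end Regs

theorem setCell_apply {β : Type*} (m : ℕ → ℕ → β) (a i : ℕ) (v : β) (b j : ℕ) :
    setCell m a i v b j = if b = a ∧ j = i then v else m b j := by
  unfold setCell
  by_cases hb : b = a
  · subst hb
    by_cases hj : j = i
    · subst hj; simp
    · simp [hj]
  · simp [hb]

/-- An upper bound on the number of steps of a program without loops and calls. -/
def _root_.Prog.steps : Prog → ℕ
  | .skip => 1
  | .setN _ e => e.cost + 1
  | .setR _ e => e.cost + 1
  | .setP _ e => e.cost + 1
  | .storeN _ i e => i.cost + e.cost + 1
  | .storeR _ i e => i.cost + e.cost + 1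
  | .storeP _ i e => i.cost + e.cost + 1
  | .seq p q => p.steps + q.steps
  | .ite b p q => b.cost + 1 + (p.steps + q.steps)
  | .loop _ _ => 0
  | .call _ _ _ _ _ => 0

variable [MetricSpace X]

/-- The weakest precondition of a program without loops and calls. -/
def wp (A M : ℕ) : Prog → Regs X → Memory X → (Regs X → Memory X → Prop) → Prop
  | .skip, R, m, Q => Q R m
  | .setN x e, R, m, Q => x < 11 ∧ Q (R.setNat x (e.val (R.state m))) m
  | .setR x e, R, m, Q => x < 8 ∧ Q (R.setReal x (e.val (R.state m))) m
  | .setP x e, R, m, Q => x < 2 ∧ Q (R.setPt x (e.val (R.state m))) m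
  | .storeN a i e, R, m, Q => a < A ∧ i.val (R.state m) < M ∧
      Q R { m with nat := setCell m.nat a (i.val (R.state m)) (e.val (R.state m)) }
  | .storeR a i e, R, m, Q => a < A ∧ i.val (R.state m) < M ∧
      Q R { m with real := setCell m.real a (i.val (R.state m)) (e.val (R.state m)) }
  | .storeP a i e, R, m, Q => a < A ∧ i.val (R.state m) < M ∧
      Q R { m with pt := setCell m.pt a (i.val (R.state m)) (e.val (R.state m)) }
  | .seq p q, R, m, Q => wp A M p R m fun R' m' => wp A M q R' m' Q
  | .ite b p q, R, m, Q =>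
      (b.val (R.state m) → wp A M p R m Q) ∧ (¬ b.val (R.state m) → wp A M q R m Q)
  -- Loops are handled by `Runs.loop` instead. The only call occurs in `report`, which is executed
  -- by hand in `exec_report`; hence `Regs.state` can fix the output to be empty.
  | .loop _ _, _, _, _ => False
  | .call _ _ _ _ _, _, _, _ => False

variable (alg : StaticAlg X) (A M : ℕ)

/-- Started with the given registers and memory, the program halts within `n` steps, and the final
registers and memory satisfy `Q`. -/
def Runs (p : Prog) (R : Regs X) (m : Memory X) (n : ℕ) (Q : Regs X → Memory X → Prop) : Prop :=
  ∃ n' ≤ n, ∃ R' m', Exec alg A M p (R.state m) n' (R'.state m') ∧ Q R' m'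

variable {alg A M}

theorem Runs.mono {p : Prog} {R : Regs X} {m : Memory X} {n n' : ℕ}
    {Q Q' : Regs X → Memory X → Prop} (h : Runs alg A M p R m n Q) (hn : n ≤ n')
    (hQ : ∀ R' m', Q R' m' → Q' R' m') : Runs alg A M p R m n' Q' := by
  obtain ⟨a, ha, R', m', h, hq⟩ := h
  exact ⟨a, ha.trans hn, R', m', h, hQ _ _ hq⟩

theorem Runs.seq {p q : Prog} {R : Regs X} {m : Memory X} {n₁ n₂ : ℕ}
    {Q₁ Q : Regs X → Memory X → Prop} (h : Runs alg A M p R m n₁ Q₁)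
    (h' : ∀ R' m', Q₁ R' m' → Runs alg A M q R' m' n₂ Q) :
    Runs alg A M (.seq p q) R m (n₁ + n₂) Q := by
  obtain ⟨a, ha, R₁, m₁, e₁, hq⟩ := h
  obtain ⟨b, hb, R₂, m₂, e₂, hq⟩ := h' _ _ hq
  exact ⟨a + b, by omega, R₂, m₂, .seq e₁ e₂, hq⟩

theorem Runs.of_wp {p : Prog} {R : Regs X} {m : Memory X} {Q : Regs X → Memory X → Prop}
    (h : wp A M p R m Q) : Runs alg A M p R m p.steps Q := by
  induction p generalizing R m Q with
  | skip => exact ⟨1, le_rfl, R, m, .skip _, h⟩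
  | setN x e =>
    refine ⟨_, le_rfl, _, m, ?_, h.2⟩
    rw [Regs.state_setNat R m h.1]
    exact .setN _ _ _
  | setR x e =>
    refine ⟨_, le_rfl, _, m, ?_, h.2⟩
    rw [Regs.state_setReal R m h.1]
    exact .setR _ _ _
  | setP x e =>
    refine ⟨_, le_rfl, _, m, ?_, h.2⟩
    rw [Regs.state_setPt R m h.1]
    exact .setP _ _ _
  | storeN a i e => exact ⟨_, le_rfl, R, _, .storeN _ _ _ _ h.1 h.2.1, h.2.2⟩
  | storeR a i e => exact ⟨_, le_rfl, R, _, .storeR _ _ _ _ h.1 h.2.1, h.2.2⟩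
  | storeP a i e => exact ⟨_, le_rfl, R, _, .storeP _ _ _ _ h.1 h.2.1, h.2.2⟩
  | seq p q ihp ihq => exact (ihp h).seq fun R' m' h' => ihq h'
  | ite b p q ihp ihq =>
    by_cases hb : b.val (R.state m)
    · obtain ⟨n, hn, R', m', he, hq⟩ := ihp (h.1 hb)
      exact ⟨_, by simp only [Prog.steps]; omega, R', m', .iteTrue _ hb he, hq⟩
    · obtain ⟨n, hn, R', m', he, hq⟩ := ihq (h.2 hb)
      exact ⟨_, by simp only [Prog.steps]; omega, R', m', .iteFalse _ hb he, hq⟩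
  | loop b p => exact h.elim
  | call a b s l x => exact h.elim

/-- The rule for a program without loops and calls whose final state is known. -/
theorem Runs.of_wp_eq {p : Prog} {R : Regs X} {m : Memory X} {Q : Regs X → Memory X → Prop}
    (R' : Regs X) (m' : Memory X) (h : wp A M p R m fun R₁ m₁ => R₁ = R' ∧ m₁ = m')
    (hQ : Q R' m') : Runs alg A M p R m p.steps Q :=
  (Runs.of_wp h).mono le_rfl fun _ _ ⟨h₁, h₂⟩ => by rwa [h₁, h₂]

/-- The rule for a loop that is known to be executed `N` times. -/
theorem Runs.loop {b : BExp} {p : Prog} {R : Regs X} {m : Memory X} {n : ℕ} (N : ℕ)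
    (I : ℕ → Regs X → Memory X → Prop) (h0 : I 0 R m)
    (hstep : ∀ j < N, ∀ R m, I j R m → b.val (R.state m) ∧ Runs alg A M p R m n (I (j + 1)))
    (hend : ∀ R m, I N R m → ¬ b.val (R.state m)) :
    Runs alg A M (.loop b p) R m (N * (b.cost + 1 + n) + (b.cost + 1)) (I N) := by
  suffices H : ∀ i j, i + j = N → ∀ R m, I j R m →
      Runs alg A M (.loop b p) R m (i * (b.cost + 1 + n) + (b.cost + 1)) (I N) from
    H N 0 (by simp) R m h0
  intro i
  induction i with
  | zero =>
    intro j hj R m hI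
    obtain rfl : j = N := by omega
    exact ⟨_, by simp, R, m, .loopFalse p (hend R m hI), hI⟩
  | succ i ih =>
    intro j hj R m hI
    obtain ⟨hb, a, ha, R₁, m₁, e₁, hI₁⟩ := hstep j (by omega) R m hI
    obtain ⟨a', ha', R₂, m₂, e₂, hq⟩ := ih (j + 1) (by omega) R₁ m₁ hI₁
    refine ⟨_, ?_, R₂, m₂, .loopTrue hb e₁ e₂, hq⟩
    rw [Nat.succ_mul]
    omega

end Machine

/-! ## Solutions and packing -/

section Clustering

-- The cheapest choice of outliers is the multiset of uncovered points. This form is monotone in `Q`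
-- and can be counted.
open Classical in
theorem isSolution_iff {X : Type u} [MetricSpace X] {k z : ℕ} {Q : Multiset X} {C : List X}
    {r : ℝ} : IsSolution k z Q C r ↔
      0 ≤ r ∧ C.length ≤ k ∧ (Q.filter fun q => ¬ ∃ c ∈ C, dist q c ≤ r).card ≤ z := by
  refine and_congr_right fun _ => and_congr_right fun _ => ⟨?_, fun h => ?_⟩
  · rintro ⟨O, R, rfl, hO, hR⟩
    rw [Multiset.filter_add, (Multiset.filter_eq_nil (s := R)).2 (fun q hq => not_not.2 (hR q hq)),
      add_zero]
    exact (Multiset.card_le_card (Multiset.filter_le _ _)).trans hO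
  · refine ⟨_, Q.filter fun q => ∃ c ∈ C, dist q c ≤ r, ?_, h, fun q hq => ?_⟩
    · rw [add_comm, Multiset.filter_add_not]
    · exact (Multiset.mem_filter.1 hq).2

open Classical in
/-- The entry `y` is assigned to the center `c`. -/
noncomputable def inGroup {X : Type u} {ι : Type*} (c : X) (y : ι × X) : Bool := decide (y.2 = c)

@[simp]
theorem inGroup_iff {X : Type u} {ι : Type*} {c : X} {y : ι × X} : inGroup c y = true ↔ y.2 = c := by
  simp [inGroup]

variable {X : Type u} [MetricSpace X] {k z : ℕ}

theorem IsSolution.of_le {P Q : Multiset X} (h : P ≤ Q) {C : List X} {r : ℝ}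
    (hs : IsSolution k z Q C r) : IsSolution k z P C r := by
  classical
  rw [isSolution_iff] at hs ⊢
  exact ⟨hs.1, hs.2.1, (Multiset.card_le_card (Multiset.filter_le_filter _ h)).trans hs.2.2⟩

theorem bddBelow_costs (Q : Multiset X) :
    BddBelow {r : ℝ | ∃ C : List X, IsSolution k z Q C r} :=
  ⟨0, fun _ ⟨_, h⟩ => h.1⟩

theorem isSolution_singleton (hk : 1 ≤ k) (Q : Multiset X) {c : X} {r : ℝ} (hr : 0 ≤ r)
    (h : ∀ q ∈ Q, dist q c ≤ r) : IsSolution k z Q [c] r :=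
  ⟨hr, by simpa using hk, 0, Q, by simp, by simp, fun q hq => ⟨c, by simp, h q hq⟩⟩

theorem nonempty_costs (hk : 1 ≤ k) (Q : Multiset X) :
    {r : ℝ | ∃ C : List X, IsSolution k z Q C r}.Nonempty := by
  classical
  rcases Q.empty_or_exists_mem with rfl | ⟨c, hc⟩
  · exact ⟨0, [], le_rfl, by simp, 0, 0, by simp, by simp, by simp⟩
  · obtain ⟨r, hr⟩ := (Q.toFinset.image fun q => dist q c).bddAbove
    have hr' : ∀ q ∈ Q, dist q c ≤ r := fun q hq =>
      hr (by simpa using ⟨q, hq, rfl⟩)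
    exact ⟨r, [c], isSolution_singleton hk Q (by simpa using hr' c hc) hr'⟩

theorem opt_nonneg (Q : Multiset X) : 0 ≤ opt k z Q :=
  Real.sInf_nonneg fun _ ⟨_, h⟩ => h.1

theorem opt_le {Q : Multiset X} {C : List X} {r : ℝ} (h : IsSolution k z Q C r) :
    opt k z Q ≤ r :=
  csInf_le (bddBelow_costs Q) ⟨C, h⟩

theorem opt_mono (hk : 1 ≤ k) {P Q : Multiset X} (h : P ≤ Q) : opt k z P ≤ opt k z Q :=
  csInf_le_csInf (bddBelow_costs P) (nonempty_costs hk Q) fun _ ⟨C, hC⟩ => ⟨C, IsSolution.of_le h hC⟩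

/-- One ball around any point of `Q` suffices. With `r = Δmax` this bounds the number of levels that
are needed. -/
theorem opt_le_of_dist_le (hk : 1 ≤ k) {Q : Multiset X} {r : ℝ} (hr : 0 ≤ r)
    (h : ∀ p ∈ Q, ∀ q ∈ Q, dist p q ≤ r) : opt k z Q ≤ r := by
  rcases Q.empty_or_exists_mem with rfl | ⟨c, hc⟩
  · exact opt_le (C := []) ⟨hr, by simp, 0, 0, by simp, by simp, by simp⟩
  · exact opt_le (isSolution_singleton hk Q hr fun q hq => h q hq c hc)

/-- If each point of `U` has at least `z + 1` points of `L` near it, then a solution for `L` can be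
extended to `L + U`. -/
theorem IsSolution.extend {L U : Multiset X} {C : List X} {r s : ℝ} (hs : 0 ≤ s)
    (h : IsSolution k z L C r)
    (hU : ∀ u ∈ U, ∃ G ≤ L, z + 1 ≤ G.card ∧ ∀ g ∈ G, dist u g ≤ s) :
    IsSolution k z (L + U) C (r + s) := by
  classical
  have hr := h.1
  obtain ⟨-, hC, O, R, rfl, hO, hR⟩ := h
  refine ⟨by linarith, hC, O, R + U, by rw [add_assoc], hO, fun q hq => ?_⟩
  rcases Multiset.mem_add.1 hq with hq | hq
  · obtain ⟨c, hc, hd⟩ := hR q hq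
    exact ⟨c, hc, by linarith⟩
  · obtain ⟨G, hG, hcard, hd⟩ := hU q hq
    obtain ⟨g, hgG, hgR⟩ : ∃ g ∈ G, g ∈ R := by
      -- Otherwise all of `G` would consist of outliers. Multiplicities are compared because a point
      -- of `X` may occur both in `O` and in `R`.
      by_contra! hno
      have : G ≤ O := by
        rw [Multiset.le_iff_count]
        intro a
        by_cases ha : a ∈ G
        · have := Multiset.le_iff_count.1 hG a
          rwa [Multiset.count_add, Multiset.count_eq_zero_of_notMem (hno a ha), add_zero] at this
        · simp [Multiset.count_eq_zero_of_notMem ha]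
      have := Multiset.card_le_card this
      omega
    obtain ⟨c, hc, hgc⟩ := hR g hgR
    refine ⟨c, hc, (dist_triangle q g c).trans ?_⟩
    linarith [hd g hgG]

/-! ### Packing in doubling spaces -/

theorem exists_cover {d : ℝ} (hX : DoublingDimLE X d) (j : ℕ) (x : X) {r : ℝ} (hr : 0 < r) :
    ∃ s : Finset X, s.card ≤ ⌊(2 : ℝ) ^ d⌋₊ ^ j ∧
      Metric.closedBall x r ⊆ ⋃ y ∈ s, Metric.closedBall y (r / 2 ^ j) := by
  classical
  induction j with
  | zero => exact ⟨{x}, by simp, by simp⟩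
  | succ j ih =>
    obtain ⟨s, hs, hcov⟩ := ih
    choose f hf hfcov using fun y => hX y (r / 2 ^ j) (by positivity)
    refine ⟨s.biUnion f, ?_, fun p hp => ?_⟩
    · rw [pow_succ]
      refine (Finset.card_biUnion_le_card_mul s f ⌊(2 : ℝ) ^ d⌋₊ fun y _ => ?_).trans
        (Nat.mul_le_mul_right _ hs)
      exact Nat.le_floor (hf y)
    · obtain ⟨y, hy, hpy⟩ := Set.mem_iUnion₂.1 (hcov hp)
      obtain ⟨w, hw, hpw⟩ := Set.mem_iUnion₂.1 (hfcov y hpy)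
      refine Set.mem_iUnion₂.2 ⟨w, Finset.mem_biUnion.2 ⟨y, hy, hw⟩, ?_⟩
      rwa [pow_succ, ← div_div]

/-- After `j` halvings the covering balls have radius at most `δ / 2`, so each contains at most one
of the separated points. -/
theorem card_le_of_separated {d : ℝ} (hX : DoublingDimLE X d) (j : ℕ) {x : X} {r δ : ℝ}
    (hr : 0 < r) (hj : 2 * r ≤ δ * 2 ^ j) (T : Finset X) (hT : ∀ c ∈ T, dist c x ≤ r)
    (hsep : ∀ c ∈ T, ∀ c' ∈ T, c ≠ c' → δ < dist c c') : T.card ≤ ⌊(2 : ℝ) ^ d⌋₊ ^ j := by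
  classical
  obtain ⟨s, hs, hcov⟩ := exists_cover hX j x hr
  refine le_trans ?_ hs
  have h2 : r / 2 ^ j ≤ δ / 2 := by
    rw [div_le_div_iff₀ (by positivity) (by norm_num)]; linarith
  have : ∀ c ∈ T, ∃ y ∈ s, dist c y ≤ δ / 2 := fun c hc => by
    obtain ⟨y, hy, hcy⟩ := Set.mem_iUnion₂.1 (hcov (Metric.mem_closedBall.2 (hT c hc)))
    exact ⟨y, hy, (Metric.mem_closedBall.1 hcy).trans h2⟩
  choose! f hf hfd using this
  refine Finset.card_le_card_of_injOn f hf fun c hc c' hc' hcc => ?_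
  by_contra hne
  have h3 := dist_triangle_right c c' (f c)
  have h4 := hfd c hc
  have h5 := hfd c' hc'
  rw [← hcc] at h5
  linarith [hsep c hc c' hc' hne]

/-- The packing property of the scale `ρ` with separation `δ`, for centers near the points of
`Y`. -/
def Packs (Y : Set X) (δ ρ : ℝ) (N : ℕ) : Prop :=
  ∀ (x : X) (r : ℝ), 0 ≤ r → r < ρ → ∀ T : Finset X,
    (∀ c ∈ T, ∃ y ∈ Y, dist y c ≤ δ ∧ dist y x ≤ r) →
    (∀ c ∈ T, ∀ c' ∈ T, c ≠ c' → δ < dist c c') → T.card ≤ N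

theorem packs_of_doubling {d : ℝ} (hX : DoublingDimLE X d) (Y : Set X) {δ ρ : ℝ} (hδ : 0 < δ)
    (hρ : 0 < ρ) {j : ℕ} (hj : 2 * (ρ + δ) ≤ δ * 2 ^ j) :
    Packs Y δ ρ (⌊(2 : ℝ) ^ d⌋₊ ^ j) := by
  intro x r _ hr T hT hsep
  refine card_le_of_separated hX j (by positivity) hj T (fun c hc => ?_) hsep (x := x)
  obtain ⟨y, _, h1, h2⟩ := hT c hc
  have := dist_triangle_left c x y
  linarith

/-- This serves level `0`, where a center coincides with its points and a ball of radius below `Δ /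
2` contains at most one point of `Y`. It is the reason why `Packs` mentions the points of `Y` and
not only the centers. -/
theorem packs_zero {Y : Set X} {Δ : ℝ} (hY : ∀ x ∈ Y, ∀ y ∈ Y, x ≠ y → Δ ≤ dist x y) {N : ℕ}
    (hN : 1 ≤ N) : Packs Y 0 (Δ / 2) N := by
  intro x r _ hr T hT _
  refine le_trans (Finset.card_le_one.2 fun c hc c' hc' => ?_) hN
  obtain ⟨y, hy, h1, h2⟩ := hT c hc
  obtain ⟨y', hy', h1', h2'⟩ := hT c' hc'
  obtain rfl := dist_le_zero.1 h1
  obtain rfl := dist_le_zero.1 h1'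
  by_contra hne
  have := hY _ hy _ hy' hne
  have := dist_triangle_right y y' x
  linarith

/-- Too many points, assigned to separated centers with at most `z + 1` points each, force the
optimum to be large. -/
theorem le_opt_of_length_lt {ι : Type*} {pt : ι → X} {δ ρ : ℝ} {N : ℕ} (hk : 1 ≤ k)
    (hpack : Packs (Set.range pt) δ ρ N) (l : List (ι × X))
    (hd : ∀ y ∈ l, dist (pt y.1) y.2 ≤ δ)
    (hsep : ∀ y ∈ l, ∀ y' ∈ l, y.2 ≠ y'.2 → δ < dist y.2 y'.2)
    (hcount : ∀ y ∈ l, l.countP (inGroup y.2) ≤ z + 1)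
    (hlen : k * N * (z + 1) + z < l.length) :
    ρ ≤ opt k z ((l.map fun y => pt y.1 : List X) : Multiset X) := by
  classical
  by_contra! hlt
  -- The infimum need not be attained, but some solution costs less than `ρ`, and `Packs` asks only
  -- for a strict inequality.
  obtain ⟨r, ⟨C, hC⟩, hr⟩ := exists_lt_of_csInf_lt (nonempty_costs hk _) hlt
  rw [isSolution_iff] at hC
  obtain ⟨hr0, hCk, hz⟩ := hC
  set cov : X → Prop := fun q => ∃ c ∈ C, dist q c ≤ r with hcov
  set lc := l.filter fun y => decide (cov (pt y.1)) with hlc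
  have hsub : lc.Sublist l := List.filter_sublist
  have hlc_len : l.length ≤ lc.length + z := by
    have h1 : (l.filter fun y => !decide (cov (pt y.1))).length ≤ z := by
      rw [Multiset.filter_coe, Multiset.coe_card, List.filter_map, List.length_map] at hz
      refine le_of_eq_of_le (congrArg List.length (List.filter_congr fun y _ => ?_)) hz
      simp only [Function.comp_apply, decide_not, cov]
    have h2 := List.length_eq_length_filter_add (l := l) fun y => decide (cov (pt y.1))
    rw [← hlc] at h2
    omega
  set T := (lc.map Prod.snd).toFinset with hT
  have hTmem : ∀ c ∈ T, ∃ y ∈ lc, y.2 = c := fun c hc => by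
    simpa [hT] using hc
  -- Every center in `T` has an entry covered by one of the at most `k` balls, and `hpack` allows at
  -- most `N` such centers per ball.
  have hTcard : T.card ≤ k * N := by
    have hsubT : T ⊆ C.toFinset.biUnion fun x => T.filter fun c =>
        ∃ y ∈ lc, y.2 = c ∧ dist (pt y.1) x ≤ r := by
      intro c hc
      obtain ⟨y, hy, rfl⟩ := hTmem c hc
      obtain ⟨x, hx, hxr⟩ : cov (pt y.1) := by simpa using (List.mem_filter.1 hy).2
      exact Finset.mem_biUnion.2 ⟨x, by simpa using hx, Finset.mem_filter.2 ⟨hc, y, hy, rfl, hxr⟩⟩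
    refine (Finset.card_le_card hsubT).trans ((Finset.card_biUnion_le_card_mul _ _ N ?_).trans
      (Nat.mul_le_mul_right _ ((List.toFinset_card_le C).trans hCk)))
    intro x _
    refine hpack x r hr0 hr _ (fun c hc => ?_) (fun c hc c' hc' hne => ?_)
    · obtain ⟨_, y, hy, rfl, hyr⟩ := Finset.mem_filter.1 hc
      exact ⟨_, ⟨_, rfl⟩, hd y (hsub.mem hy), hyr⟩
    · obtain ⟨y, hy, rfl⟩ := hTmem c (Finset.mem_filter.1 hc).1
      obtain ⟨y', hy', rfl⟩ := hTmem c' (Finset.mem_filter.1 hc').1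
      exact hsep y (hsub.mem hy) y' (hsub.mem hy') hne
  have hlcT : lc.length ≤ T.card * (z + 1) := by
    rw [← List.length_map (f := Prod.snd) (as := lc), ← List.sum_toFinset_count_eq_length]
    refine Finset.sum_le_card_nsmul _ _ _ fun c hc => ?_
    obtain ⟨y, hy, rfl⟩ := hTmem c hc
    refine le_trans ?_ (hcount y (hsub.mem hy))
    rw [List.count, List.countP_map]
    refine le_of_eq_of_le (List.countP_congr fun y' _ => ?_) hsub.countP_le
    simp [inGroup]
  have := Nat.mul_le_mul_right (z + 1) hTcard
  omega

end Clustering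

/-! ## One level of the sketch -/

section Level

variable {X : Type u}

/-- The indices of the points in the window. -/
noncomputable def windowIdx (S : PointStream X) (W t : ℝ) : Finset S.ι :=
  ((S.finite_arr t).subset
    (fun _ h => h.1 : {i | S.arr i ≤ t ∧ t < S.arr i + W} ⊆ {i | S.arr i ≤ t})).toFinset

theorem mem_windowIdx {S : PointStream X} {W t : ℝ} {i : S.ι} :
    i ∈ windowIdx S W t ↔ S.arr i ≤ t ∧ t < S.arr i + W := by
  simp [windowIdx]

theorem window_eq (S : PointStream X) (W t : ℝ) :
    S.window W t = (windowIdx S W t).val.map S.pt := rfl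

/-- The entry `y` is assigned to the center `c` and is newer than the point with index `i`. -/
noncomputable def newer (S : PointStream X) (i : S.ι) (c : X) (y : S.ι × X) : Bool :=
  inGroup c y && decide (S.arr i < S.arr y.1)

theorem newer_iff {S : PointStream X} {i : S.ι} {c : X} {y : S.ι × X} :
    newer S i c y = true ↔ y.2 = c ∧ S.arr i < S.arr y.1 := by
  simp [newer]

open Classical in
/-- The effect on a level of the departure at time `t`. -/
noncomputable def expire (S : PointStream X) (W t : ℝ) : List (S.ι × X) → List (S.ι × X)
  | [] => []
  | y :: l => if S.arr y.1 + W ≤ t then l else y :: l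

theorem expire_eq_self {S : PointStream X} {W : ℝ} {t : ℝ} {l : List (S.ι × X)}
    (h : ∀ y ∈ l, t < S.arr y.1 + W) : expire S W t l = l := by
  cases l with
  | nil => rfl
  | cons y l => simp [expire, h y]

variable [MetricSpace X]

/-- The invariant of the level with radius `δ` at time `t`. The list `l` consists of the stored
points with their centers in the order of arrival, and `e` is the latest expiration time of a point
that was discarded for lack of space. -/
structure LevelInv (S : PointStream X) (W δ ρ : ℝ) (k z cap : ℕ) (t : ℝ) (l : List (S.ι × X))
    (e : Option ℝ) : Prop where
  sorted : l.Pairwise fun y y' => S.arr y.1 < S.arr y'.1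
  active : ∀ y ∈ l, S.arr y.1 ≤ t ∧ t < S.arr y.1 + W
  near : ∀ y ∈ l, dist (S.pt y.1) y.2 ≤ δ
  sep : ∀ y ∈ l, ∀ y' ∈ l, y.2 ≠ y'.2 → δ < dist y.2 y'.2
  group : ∀ c, l.countP (inGroup c) ≤ z + 1
  len : l.length ≤ cap
  cover : ∀ i, S.arr i ≤ t → t < S.arr i + W → (∀ e₀, e = some e₀ → e₀ < S.arr i + W) →
    (∃ c, (i, c) ∈ l) ∨ ∃ c, dist (S.pt i) c ≤ δ ∧ z + 1 ≤ l.countP (newer S i c)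
  later : ∀ e₀, e = some e₀ → ∀ y ∈ l, e₀ < S.arr y.1 + W
  past : ∀ e₀, e = some e₀ → e₀ ≤ t + W
  large : ∀ e₀, e = some e₀ → ∃ Q : Finset S.ι, (∀ i ∈ Q, S.arr i ≤ t ∧ e₀ ≤ S.arr i + W) ∧
    ρ ≤ opt k z (Q.val.map S.pt)

/-- The point `c` may be used as the center of the arriving point `p`. -/
def IsCenterFor {ι : Type*} (δ : ℝ) (p : X) (l : List (ι × X)) (c : X) : Prop :=
  (∃ y ∈ l, y.2 = c ∧ dist p c ≤ δ) ∨ (c = p ∧ ∀ y ∈ l, δ < dist p y.2)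

/-- The effect on a level of the arrival of the point with index `i`, which is assigned to `c`. -/
def Inserts (S : PointStream X) (W : ℝ) (z cap : ℕ) (i : S.ι) (c : X) (l : List (S.ι × X))
    (e : Option ℝ) (l' : List (S.ι × X)) (e' : Option ℝ) : Prop :=
  ∃ l₀, l' = l₀ ++ [(i, c)] ∧
    ((z + 1 ≤ l.countP (inGroup c) ∧ l₀ = l.eraseP (inGroup c) ∧ e' = e) ∨
     (l.countP (inGroup c) < z + 1 ∧ cap ≤ l.length ∧
        ∃ a, l = a :: l₀ ∧ e' = some (S.arr a.1 + W)) ∨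
     (l.countP (inGroup c) < z + 1 ∧ l.length < cap ∧ l₀ = l ∧ e' = e))

variable {S : PointStream X} {W δ ρ : ℝ} {k z cap : ℕ}

theorem LevelInv.empty {t : ℝ} (h : ∀ i, t < S.arr i) :
    LevelInv S W δ ρ k z cap t [] none where
  sorted := .nil
  active := by simp
  near := by simp
  sep := by simp
  group := by simp
  len := by simp
  cover i hi := absurd (h i) (not_lt.2 hi)
  later := by simp
  past := by simp
  large := by simp

/-- Between the events the invariant is kept. -/
theorem LevelInv.idle {t t' : ℝ} {l : List (S.ι × X)} {e : Option ℝ}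
    (h : LevelInv S W δ ρ k z cap t l e) (ht : t ≤ t')
    (hw : windowIdx S W t' = windowIdx S W t) : LevelInv S W δ ρ k z cap t' l e where
  sorted := h.sorted
  active y hy := mem_windowIdx.1 (hw ▸ mem_windowIdx.2 (h.active y hy))
  near := h.near
  sep := h.sep
  group := h.group
  len := h.len
  cover i h1 h2 := by
    have := mem_windowIdx.1 (hw ▸ mem_windowIdx.2 ⟨h1, h2⟩)
    exact h.cover i this.1 this.2
  later := h.later
  past e₀ he := by linarith [h.past e₀ he]
  large e₀ he := by
    obtain ⟨Q, hQ, h'⟩ := h.large e₀ he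
    exact ⟨Q, fun i hi => ⟨(hQ i hi).1.trans ht, (hQ i hi).2⟩, h'⟩

/-- The departure of the point with index `q`. -/
theorem LevelInv.expire {t t' : ℝ} {l : List (S.ι × X)} {e : Option ℝ} {q : S.ι}
    (h : LevelInv S W δ ρ k z cap t l e) (ht : t ≤ t')
    (hq : S.arr q + W = t') (hw : ∀ i, S.arr i ≤ t ∧ t < S.arr i + W ↔
      (S.arr i ≤ t' ∧ t' < S.arr i + W) ∨ i = q) :
    LevelInv S W δ ρ k z cap t' (expire S W t' l) e := by
  have hsub : (SlidingKCenter.expire S W t' l).Sublist l := by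
    cases l with
    | nil => exact .slnil
    | cons y l =>
      rw [SlidingKCenter.expire]
      split_ifs
      · exact List.sublist_cons_self _ _
      · exact .refl _
  have hact : ∀ y ∈ SlidingKCenter.expire S W t' l, S.arr y.1 ≤ t' ∧ t' < S.arr y.1 + W := by
    intro y hy
    rcases (hw y.1).1 (h.active y (hsub.mem hy)) with h' | h'
    · exact h'
    -- If the departing point is stored, it is the oldest active point and therefore the head of the
    -- list, which `expire` removes.
    · exfalso
      cases l with
      | nil => simp [SlidingKCenter.expire] at hy
      | cons a l =>
        have hs := List.pairwise_cons.1 h.sorted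
        rw [SlidingKCenter.expire] at hy
        split_ifs at hy with ha
        · have h1 := hs.1 y hy
          rcases (hw a.1).1 (h.active a (by simp)) with h2 | h2
          · linarith
          · rw [h', h2] at h1
            exact lt_irrefl _ h1
        · rcases List.mem_cons.1 hy with rfl | hy
          · exact ha (by rw [h', hq])
          · have := hs.1 y hy
            rw [h'] at this
            linarith
  have hkeep : ∀ y ∈ l, t' < S.arr y.1 + W → y ∈ SlidingKCenter.expire S W t' l := by
    intro y hy hyt
    cases l with
    | nil => simp at hy
    | cons a l =>
      rw [SlidingKCenter.expire]
      split_ifs with ha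
      · rcases List.mem_cons.1 hy with rfl | hy
        · exact absurd hyt (not_lt.2 ha)
        · exact hy
      · exact hy
  refine ⟨h.sorted.sublist hsub, hact, fun y hy => h.near y (hsub.mem hy),
    fun y hy y' hy' => h.sep y (hsub.mem hy) y' (hsub.mem hy'),
    fun c => hsub.countP_le.trans (h.group c), hsub.length_le.trans h.len, ?_,
    fun e₀ he y hy => h.later e₀ he y (hsub.mem hy),
    fun e₀ he => by linarith [h.past e₀ he], fun e₀ he => ?_⟩
  · intro i h1 h2 he
    have hi := (hw i).2 (.inl ⟨h1, h2⟩)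
    rcases h.cover i hi.1 hi.2 he with ⟨c, hc⟩ | ⟨c, hd, hc⟩
    · exact .inl ⟨c, hkeep _ hc h2⟩
    · refine .inr ⟨c, hd, hc.trans ?_⟩
      cases l with
      | nil => simp [SlidingKCenter.expire]
      | cons a l =>
        rw [SlidingKCenter.expire]
        split_ifs with ha
        -- The removed head has expired and point `i` has not, so the head was not counted among the
        -- entries newer than `i`.
        · rw [List.countP_cons_of_neg]
          rw [newer_iff]
          rintro ⟨-, hlt⟩
          linarith
        · exact le_rfl
  · obtain ⟨Q, hQ, h'⟩ := h.large e₀ he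
    exact ⟨Q, fun i hi => ⟨(hQ i hi).1.trans ht, (hQ i hi).2⟩, h'⟩

/-- The arrival of the point with index `i`. -/
theorem LevelInv.insert {t : ℝ} {l l' : List (S.ι × X)} {e e' : Option ℝ} {i : S.ι} {c : X}
    {N : ℕ} (h : LevelInv S W δ ρ k z cap t l e) (hδ : 0 ≤ δ) (hW : 0 < W) (hk : 1 ≤ k)
    (hN : 1 ≤ N) (hcap : cap = k * N * (z + 1) + z) (hpack : Packs (Set.range S.pt) δ ρ N)
    (ht : t < S.arr i)
    (hw : ∀ j, S.arr j ≤ S.arr i ∧ S.arr i < S.arr j + W ↔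
      (S.arr j ≤ t ∧ t < S.arr j + W) ∨ j = i)
    (hc : IsCenterFor δ (S.pt i) l c) (hins : Inserts S W z cap i c l e l' e') :
    LevelInv S W δ ρ k z cap (S.arr i) l' e' := by
  have hkN : 1 ≤ k * N := Nat.mul_pos hk hN
  have hcap1 : z + 1 ≤ cap := by
    rw [hcap]; nlinarith
  have hdc : dist (S.pt i) c ≤ δ := by
    rcases hc with ⟨y, -, -, hd⟩ | ⟨rfl, -⟩
    · exact hd
    · simpa using hδ
  have hsepc : ∀ y ∈ l, y.2 ≠ c → δ < dist y.2 c := by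
    intro y hy hne
    rcases hc with ⟨y', hy', rfl, -⟩ | ⟨rfl, hc⟩
    · exact h.sep y hy y' hy' hne
    · rw [dist_comm]; exact hc y hy
  obtain ⟨l₀, rfl, hcase⟩ := hins
  have hsub : l₀.Sublist l := by
    rcases hcase with ⟨-, rfl, -⟩ | ⟨-, -, a, rfl, -⟩ | ⟨-, -, rfl, -⟩
    · exact List.eraseP_sublist
    · exact List.sublist_cons_self _ _
    · exact .refl _
  have hact : ∀ y ∈ l, S.arr y.1 ≤ S.arr i ∧ S.arr i < S.arr y.1 + W := fun y hy =>
    (hw y.1).2 (.inl (h.active y hy))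
  have hlt : ∀ y ∈ l, S.arr y.1 < S.arr i := fun y hy => (h.active y hy).1.trans_lt ht
  have hmem : ∀ {l₁ : List (S.ι × X)}, l₁.Sublist l → ∀ y ∈ l₁ ++ [(i, c)],
      y ∈ l ∨ y = (i, c) := fun hl y hy => by
    rcases List.mem_append.1 hy with hy | hy
    · exact .inl (hl.mem hy)
    · exact .inr (by simpa using hy)
  have hnear : ∀ {l₁ : List (S.ι × X)}, l₁.Sublist l → ∀ y ∈ l₁ ++ [(i, c)],
      dist (S.pt y.1) y.2 ≤ δ := fun hl y hy => by
    rcases hmem hl y hy with hy | rfl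
    · exact h.near y hy
    · exact hdc
  have hsep : ∀ {l₁ : List (S.ι × X)}, l₁.Sublist l → ∀ y ∈ l₁ ++ [(i, c)],
      ∀ y' ∈ l₁ ++ [(i, c)], y.2 ≠ y'.2 → δ < dist y.2 y'.2 := fun hl y hy y' hy' hne => by
    rcases hmem hl y hy with hy | rfl <;> rcases hmem hl y' hy' with hy' | rfl
    · exact h.sep y hy y' hy' hne
    · exact hsepc y hy hne
    · rw [dist_comm]; exact hsepc y' hy' hne.symm
    · exact absurd rfl hne
  have hgroup : ∀ {l₁ : List (S.ι × X)}, l₁.Sublist l → l₁.countP (inGroup c) < z + 1 →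
      ∀ c', (l₁ ++ [(i, c)]).countP (inGroup c') ≤ z + 1 := fun {l₁} hl hlt c' => by
    rw [List.countP_append, List.countP_singleton]
    by_cases hcc : c = c'
    · subst hcc; simp; omega
    · have := hl.countP_le (p := inGroup c')
      have := h.group c'
      simp [hcc]; omega
  have hnewer : ∀ j, S.arr j ≤ t → newer S j c (i, c) = true := fun j hj =>
    newer_iff.2 ⟨rfl, hj.trans_lt ht⟩
  -- The field `past` exists for this: the arriving point expires after every recorded time.
  have hnew : ∀ e₀, e = some e₀ → e₀ < S.arr i + W := fun e₀ he => by
    linarith [h.past e₀ he]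
  have hpast : ∀ e₀, e = some e₀ → e₀ ≤ S.arr i + W := fun e₀ he => (hnew e₀ he).le
  have hlarge : ∀ e₀, e = some e₀ → ∃ Q : Finset S.ι,
      (∀ j ∈ Q, S.arr j ≤ S.arr i ∧ e₀ ≤ S.arr j + W) ∧ ρ ≤ opt k z (Q.val.map S.pt) := by
    intro e₀ he
    obtain ⟨Q, hQ, h'⟩ := h.large e₀ he
    exact ⟨Q, fun j hj => ⟨(hQ j hj).1.trans ht.le, (hQ j hj).2⟩, h'⟩
  have hsorted : (l₀ ++ [(i, c)]).Pairwise fun y y' => S.arr y.1 < S.arr y'.1 :=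
    List.pairwise_append.2 ⟨h.sorted.sublist hsub, List.pairwise_singleton _ _,
      fun y hy y' hy' => by rw [List.mem_singleton.1 hy']; exact hlt y (hsub.mem hy)⟩
  have hactive : ∀ y ∈ l₀ ++ [(i, c)], S.arr y.1 ≤ S.arr i ∧ S.arr i < S.arr y.1 + W :=
    fun y hy => by
      rcases hmem hsub y hy with hy | rfl
      · exact hact y hy
      · exact ⟨le_rfl, by linarith⟩
  have hlen_app : (l₀ ++ [(i, c)]).length = l₀.length + 1 := by simp
  rcases hcase with ⟨hcnt, rfl, rfl⟩ | ⟨hcnt, hfull, a, rfl, rfl⟩ | ⟨hcnt, hfree, rfl, rfl⟩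
  · obtain ⟨b, hb, hbc⟩ := List.countP_pos_iff.1 (show 0 < l.countP (inGroup c) by omega)
    obtain ⟨a, l₁, l₂, hl₁, ha, hl, her⟩ := List.exists_of_eraseP hb hbc
    have hcl : l.countP (inGroup c) = l₂.countP (inGroup c) + 1 := by
      rw [hl, List.countP_append, List.countP_cons_of_pos ha, List.countP_eq_zero.2 hl₁, zero_add]
    have hg := h.group c
    refine ⟨hsorted, hactive, hnear hsub, hsep hsub, hgroup hsub ?_, ?_, ?_, ?_, hpast, hlarge⟩
    · rw [her, List.countP_append, List.countP_eq_zero.2 hl₁]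
      omega
    · rw [hlen_app, her]
      have h1 := h.len
      rw [hl] at h1
      simp only [List.length_append, List.length_cons] at h1 ⊢
      omega
    · intro j h1 h2 he
      rcases (hw j).1 ⟨h1, h2⟩ with hj | rfl
      swap
      · exact .inl ⟨c, by simp⟩
      rw [her]
      rcases h.cover j hj.1 hj.2 he with ⟨c', hc'⟩ | ⟨c', hd', hc'⟩
      · rw [hl] at hc'
        -- If `j` is the entry just dropped, it was the oldest of its group; the `z` remaining
        -- members and the new entry are the `z + 1` newer ones.
        by_cases hja : (j, c') = a
        · right
          refine ⟨c, ?_, ?_⟩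
          · have := h.near (j, c') (by rw [hl]; exact hc')
            rw [hja, inGroup_iff.1 ha, ← hja] at this
            exact this
          · have h3 : l₂.countP (newer S j c) = l₂.countP (inGroup c) := by
              refine List.countP_congr fun y hy => ?_
              rw [newer_iff, inGroup_iff, and_iff_left]
              have h4 := h.sorted
              rw [hl] at h4
              have := (List.pairwise_cons.1 (List.pairwise_append.1 h4).2.1).1 y hy
              rwa [← hja] at this
            rw [List.countP_append, List.countP_append, h3, List.countP_singleton,
              hnewer j hj.1]
            simp only [if_true]
            omega
        · left
          refine ⟨c', ?_⟩
          simp only [List.mem_append, List.mem_cons] at hc' ⊢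
          tauto
      · right
        refine ⟨c', hd', hc'.trans ?_⟩
        rw [hl]
        simp only [List.countP_append, List.countP_cons, List.countP_nil]
        -- If the dropped entry was counted for `j`, then `c'` is the group of the arriving point,
        -- and the new entry takes its place in the count.
        by_cases hna : newer S j c' a = true
        · obtain rfl : c' = c := (newer_iff.1 hna).1.symm.trans (inGroup_iff.1 ha)
          rw [hnewer j hj.1, hna]
          omega
        · rw [if_neg hna]
          omega
    · intro e₀ he y hy
      rcases hmem hsub y hy with hy | rfl
      · exact h.later e₀ he y hy
      · exact hnew e₀ he
  · have hs := List.pairwise_cons.1 h.sorted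
    refine ⟨hsorted, hactive, hnear hsub, hsep hsub,
      hgroup hsub (hsub.countP_le.trans_lt hcnt), ?_, ?_, ?_, ?_, ?_⟩
    · rw [hlen_app]
      exact h.len
    · intro j h1 h2 he
      have haj := he _ rfl
      rcases (hw j).1 ⟨h1, h2⟩ with hj | rfl
      swap
      · exact .inl ⟨c, by simp⟩
      -- Only points expiring after the dropped entry `a` still need to be covered. They are newer
      -- than `a`, so losing `a` affects neither their own entries nor their counts.
      rcases h.cover j hj.1 hj.2 fun e₀ he₀ =>
        (h.later e₀ he₀ a (by simp)).trans haj with ⟨c', hc'⟩ | ⟨c', hd', hc'⟩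
      · left
        refine ⟨c', List.mem_append_left _ ?_⟩
        rcases List.mem_cons.1 hc' with rfl | hc'
        · exact absurd haj (lt_irrefl _)
        · exact hc'
      · right
        refine ⟨c', hd', hc'.trans ?_⟩
        rw [List.countP_cons_of_neg, List.countP_append]
        · exact Nat.le_add_right _ _
        · rw [newer_iff]
          rintro ⟨-, h3⟩
          linarith
    · intro e₀ he y hy
      obtain rfl := Option.some.inj he
      rcases List.mem_append.1 hy with hy | hy
      · linarith [hs.1 y hy]
      · rw [List.mem_singleton.1 hy]
        linarith [hlt a (by simp)]
    · intro e₀ he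
      obtain rfl := Option.some.inj he
      linarith [hlt a (by simp)]
    · intro e₀ he
      obtain rfl := Option.some.inj he
      classical
      have hnd : (((a :: l₀) ++ [(i, c)]).map Prod.fst).Nodup := by
        refine List.pairwise_map.2 (List.Pairwise.imp (fun {y y'} hlt' heq => ?_)
          (List.pairwise_cons.2 ⟨fun y hy => ?_, hsorted⟩ :
            (a :: (l₀ ++ [(i, c)])).Pairwise fun y y' => S.arr y.1 < S.arr y'.1))
        · rw [heq] at hlt'
          exact lt_irrefl _ hlt'
        · rcases List.mem_append.1 hy with hy | hy
          · exact hs.1 y hy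
          · rw [List.mem_singleton.1 hy]
            exact hlt a (by simp)
      -- The witness for `large` is the full list before the removal together with the new point:
      -- `cap + 1` points, of which `a` expires first.
      refine ⟨⟨_, Multiset.coe_nodup.2 hnd⟩, fun j hj => ?_, ?_⟩
      · obtain ⟨y, hy, rfl⟩ := List.mem_map.1 (Multiset.mem_coe.1 (Finset.mem_mk.1 hj))
        rcases hmem (.refl _) y hy with hy | rfl
        · refine ⟨(hact y hy).1, ?_⟩
          rcases List.mem_cons.1 hy with rfl | hy
          · exact le_rfl
          · linarith [hs.1 y hy]
        · exact ⟨le_rfl, by linarith [hlt a (by simp)]⟩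
      · have := le_opt_of_length_lt (k := k) (z := z) hk hpack _ (hnear (.refl (a :: l₀)))
          (hsep (.refl _)) (fun y _ => hgroup (.refl _) hcnt y.2) (by
            rw [List.length_append, List.length_singleton, ← hcap]
            omega)
        simpa [Function.comp_def] using this
  · refine ⟨hsorted, hactive, hnear hsub, hsep hsub, hgroup hsub hcnt, ?_, ?_, ?_, hpast, hlarge⟩
    · rw [hlen_app]
      omega
    · intro j h1 h2 he
      rcases (hw j).1 ⟨h1, h2⟩ with hj | rfl
      swap
      · exact .inl ⟨c, by simp⟩
      rcases h.cover j hj.1 hj.2 he with ⟨c', hc'⟩ | ⟨c', hd', hc'⟩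
      · exact .inl ⟨c', List.mem_append_left _ hc'⟩
      · refine .inr ⟨c', hd', hc'.trans ?_⟩
        rw [List.countP_append]
        exact Nat.le_add_right _ _
    · intro e₀ he y hy
      rcases hmem hsub y hy with hy | rfl
      · exact h.later e₀ he y hy
      · exact hnew e₀ he

/-- The stored points of a level that is valid at time `t` are a coreset of the window. -/
theorem LevelInv.coreset {t : ℝ} {l : List (S.ι × X)} {e : Option ℝ}
    (h : LevelInv S W δ ρ k z cap t l e) (hδ : 0 ≤ δ) (he : ∀ e₀, e = some e₀ → e₀ ≤ t) :
    ((l.map fun y => S.pt y.1 : List X) : Multiset X) ≤ S.window W t ∧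
    ∀ C r, IsSolution k z ((l.map fun y => S.pt y.1 : List X) : Multiset X) C r →
      IsSolution k z (S.window W t) C (r + 2 * δ) := by
  classical
  have hnd : ((l.map Prod.fst : List S.ι) : Multiset S.ι).Nodup := by
    rw [Multiset.coe_nodup]
    refine List.pairwise_map.2 (h.sorted.imp fun hlt heq => ?_)
    rw [heq] at hlt
    exact lt_irrefl _ hlt
  have hle : ((l.map Prod.fst : List S.ι) : Multiset S.ι) ≤ (windowIdx S W t).val := by
    refine (Multiset.le_iff_subset hnd).2 fun j hj => ?_
    obtain ⟨y, hy, rfl⟩ := List.mem_map.1 (Multiset.mem_coe.1 hj)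
    exact mem_windowIdx.2 (h.active y hy)
  have hmap : ((l.map fun y => S.pt y.1 : List X) : Multiset X) =
      ((l.map Prod.fst : List S.ι) : Multiset S.ι).map S.pt := by
    simp [Function.comp_def]
  have hsplit : S.window W t = ((l.map fun y => S.pt y.1 : List X) : Multiset X) +
      ((windowIdx S W t).val - ((l.map Prod.fst : List S.ι) : Multiset S.ι)).map S.pt := by
    rw [hmap, ← Multiset.map_add, add_tsub_cancel_of_le hle, window_eq]
  rw [hsplit]
  refine ⟨Multiset.le_add_right _ _, fun C r hs => IsSolution.extend (by linarith) hs fun u hu => ?_⟩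
  obtain ⟨i, hi, rfl⟩ := Multiset.mem_map.1 hu
  obtain ⟨hiw, hil⟩ := (Multiset.mem_sub_of_nodup (windowIdx S W t).nodup).1 hi
  have hiw := mem_windowIdx.1 hiw
  rcases h.cover i hiw.1 hiw.2 fun e₀ h' => (he e₀ h').trans_lt hiw.2 with ⟨c, hc⟩ | ⟨c, hd, hc⟩
  · exact absurd (Multiset.mem_coe.2 (List.mem_map.2 ⟨_, hc, rfl⟩)) hil
  -- The newer members of the group of `c` serve as the nearby points: both they and point `i` are
  -- within `δ` of `c`, hence within `2 * δ` of each other.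
  · refine ⟨((l.filter (newer S i c)).map fun y => S.pt y.1 : List X), ?_, ?_, ?_⟩
    · exact Multiset.coe_le.2 (List.filter_sublist.map _).subperm
    · rwa [Multiset.coe_card, List.length_map, ← List.countP_eq_length_filter]
    · intro g hg
      obtain ⟨y, hy, rfl⟩ := List.mem_map.1 (Multiset.mem_coe.1 hg)
      obtain ⟨hyl, hyn⟩ := List.mem_filter.1 hy
      have h1 := (newer_iff.1 hyn).1
      have h2 := h.near y hyl
      rw [h1] at h2
      linarith [dist_triangle_right (S.pt i) (S.pt y.1) c]

/-- If a level is invalid at time `t`, then the optimum is large. -/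
theorem LevelInv.le_opt {t : ℝ} {l : List (S.ι × X)} {e₀ : ℝ}
    (h : LevelInv S W δ ρ k z cap t l (some e₀)) (hk : 1 ≤ k) (he : t < e₀) :
    ρ ≤ opt k z (S.window W t) := by
  obtain ⟨Q, hQ, h'⟩ := h.large e₀ rfl
  refine h'.trans (opt_mono hk (Multiset.map_le_map (Finset.val_le_iff.2 fun i hi => ?_)))
  exact mem_windowIdx.2 ⟨(hQ i hi).1, he.trans_le (hQ i hi).2⟩

end Level

/-! ## The handling of one level -/

section LevelProgram

/-- `while src + 1 ≤ last`. -/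
def srcGuard : BExp := .nle (.add (.reg 6) (.lit 1)) (.reg 10)

/-- Advance the source pointer. -/
def srcNext : Prog := .setN 6 (.add (.reg 6) (.lit 1))

/-- Test whether the entry at the source pointer is assigned to the center in register `1`. -/
def srcInGroup : BExp := .rle (.dist (.reg 1) (.load 1 (.reg 6))) (.lit 0)

/-- One step of the search for a center of the arriving point. -/
def findBody : Prog :=
  .seq (.ite (.rle (.dist (.reg 0) (.load 1 (.reg 6))) (.reg 6)) (.setP 1 (.load 1 (.reg 6))) .skip)
    srcNext

/-- One step of the computation of the size of a group. -/
def countBody : Prog :=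
  .seq (.ite srcInGroup (.setN 8 (.add (.reg 8) (.lit 1))) .skip) srcNext

/-- One step of copying the entries, where the first entry of the group is left out if the mode
is `1`. -/
def copyBody : Prog :=
  .seq
    (.ite (.and (.nle (.lit 1) (.reg 9)) srcInGroup) (.setN 9 (.lit 0))
      (.seq (.storeP 0 (.reg 7) (.load 0 (.reg 6)))
        (.seq (.storeP 1 (.reg 7) (.load 1 (.reg 6)))
          (.seq (.storeR 0 (.reg 7) (.load 0 (.reg 6)))
            (.setN 7 (.add (.reg 7) (.lit 1)))))))
    srcNext

/-- Preparation of a level. -/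
def levelInit : Prog :=
  .seq (.storeR 2 (.reg 4) (.add (.reg 6) (.reg 6)))
    (.seq (.setN 6 (.load 0 (.reg 4))) (.seq (.setN 10 (.load 1 (.reg 4))) (.setP 1 (.reg 0))))

/-- Preparation of the computation of the size of a group. -/
def countInit : Prog := .seq (.setN 6 (.load 0 (.reg 4))) (.setN 8 (.lit 0))

/-- Decide which entry has to be discarded. -/
def discard : Prog :=
  .seq (.setN 6 (.load 0 (.reg 4))) (.seq (.setN 7 (.reg 5)) (.seq (.setN 9 (.lit 0))
    (.ite (.nle (.add (.reg 1) (.lit 1)) (.reg 8)) (.setN 9 (.lit 1))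
      (.ite (.nle (.reg 3) (.sub (.reg 10) (.reg 6)))
        (.seq (.storeN 2 (.reg 4) (.lit 1)) (.seq (.storeR 1 (.reg 4) (.load 0 (.reg 6))) srcNext))
        .skip))))

/-- Append the new entry. -/
def append : Prog :=
  .seq (.storeP 0 (.reg 7) (.reg 0)) (.seq (.storeP 1 (.reg 7) (.reg 1))
    (.seq (.storeR 0 (.reg 7) (.add (.reg 0) (.reg 1)))
      (.seq (.storeN 0 (.reg 4) (.reg 5)) (.storeN 1 (.reg 4) (.add (.reg 7) (.lit 1))))))

/-- The arrival of a point at one level. -/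
def levelArrive : Prog :=
  .seq levelInit (.seq (.loop srcGuard findBody) (.seq countInit (.seq (.loop srcGuard countBody)
    (.seq discard (.seq (.loop srcGuard copyBody) append)))))

variable {X : Type u}

/-- The entries of the list `l` are stored from address `s` on. -/
def Cells (S : PointStream X) (W : ℝ) (m : Memory X) (s : ℕ) (l : List (S.ι × X)) : Prop :=
  ∀ j (h : j < l.length), m.pt 0 (s + j) = some (S.pt l[j].1) ∧ m.pt 1 (s + j) = some l[j].2 ∧
    m.real 0 (s + j) = S.arr l[j].1 + W

/-- The memory represents the list `l` and the discarding time `e` at level `i`. -/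
structure LevelRep (S : PointStream X) (W : ℝ) (cap : ℕ) (m : Memory X) (i : ℕ)
    (l : List (S.ι × X)) (e : Option ℝ) : Prop where
  last : m.nat 1 i = m.nat 0 i + l.length
  range : ∀ j < l.length, i * cap ≤ m.nat 0 i + j ∧ m.nat 0 i + j < (i + 1) * cap
  cells : Cells S W m (m.nat 0 i) l
  flag_none : e = none → m.nat 2 i = 0
  flag_some : ∀ e₀, e = some e₀ → m.nat 2 i = 1 ∧ m.real 1 i = e₀

/-- Only the memory cells that belong to level `i` are changed. -/
structure SameOff (cap i : ℕ) (m m' : Memory X) : Prop where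
  nat : ∀ i' ≠ i, m'.nat 0 i' = m.nat 0 i' ∧ m'.nat 1 i' = m.nat 1 i' ∧ m'.nat 2 i' = m.nat 2 i'
  real : ∀ i' ≠ i, m'.real 1 i' = m.real 1 i' ∧ m'.real 2 i' = m.real 2 i'
  cells : ∀ j, j < i * cap ∨ (i + 1) * cap ≤ j →
    m'.pt 0 j = m.pt 0 j ∧ m'.pt 1 j = m.pt 1 j ∧ m'.real 0 j = m.real 0 j

theorem SameOff.trans {cap i : ℕ} {m m' m'' : Memory X} (h : SameOff cap i m m')
    (h' : SameOff cap i m' m'') : SameOff cap i m m'' where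
  nat i' hi := by
    obtain ⟨h1, h2, h3⟩ := h'.nat i' hi
    rw [h1, h2, h3]
    exact h.nat i' hi
  real i' hi := by
    obtain ⟨h1, h2⟩ := h'.real i' hi
    rw [h1, h2]
    exact h.real i' hi
  cells j hj := by
    obtain ⟨h1, h2, h3⟩ := h'.cells j hj
    rw [h1, h2, h3]
    exact h.cells j hj

theorem LevelRep.congr {S : PointStream X} {W : ℝ} {cap i i' : ℕ} {m m' : Memory X}
    {l : List (S.ι × X)} {e : Option ℝ} (h : LevelRep S W cap m i' l e)
    (hm : SameOff cap i m m') (hi : i' ≠ i) : LevelRep S W cap m' i' l e := by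
  obtain ⟨h0, h1, h2⟩ := hm.nat i' hi
  obtain ⟨h3, -⟩ := hm.real i' hi
  refine ⟨by rw [h1, h0, h.last], by rw [h0]; exact h.range, ?_, by rw [h2]; exact h.flag_none,
    by rw [h2, h3]; exact h.flag_some⟩
  rw [h0]
  intro j hj
  obtain ⟨hr1, hr2⟩ := h.range j hj
  have : m.nat 0 i' + j < i * cap ∨ (i + 1) * cap ≤ m.nat 0 i' + j := by
    rcases lt_or_gt_of_ne hi with hlt | hlt
    · exact .inl (hr2.trans_le (Nat.mul_le_mul_right cap hlt))
    · exact .inr ((Nat.mul_le_mul_right cap hlt).trans hr1)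
  obtain ⟨h5, h6, h7⟩ := hm.cells _ this
  rw [h5, h6, h7]
  exact h.cells j hj

theorem Cells.snoc {S : PointStream X} {W : ℝ} {m : Memory X} {s : ℕ} {l : List (S.ι × X)} {y : S.ι × X}
    (h : Cells S W m s l) (h0 : m.pt 0 (s + l.length) = some (S.pt y.1))
    (h1 : m.pt 1 (s + l.length) = some y.2) (h2 : m.real 0 (s + l.length) = S.arr y.1 + W) :
    Cells S W m s (l ++ [y]) := by
  intro j hj
  rw [List.length_append, List.length_singleton] at hj
  rcases Nat.lt_succ_iff_lt_or_eq.1 hj with hj | rfl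
  · rw [List.getElem_append_left hj]
    exact h j hj
  · simpa using ⟨h0, h1, h2⟩

theorem Cells.congr {S : PointStream X} {W : ℝ} {m m' : Memory X} {s : ℕ} {l : List (S.ι × X)} (h : Cells S W m s l)
    (hm : ∀ j < l.length, m'.pt 0 (s + j) = m.pt 0 (s + j) ∧
      m'.pt 1 (s + j) = m.pt 1 (s + j) ∧ m'.real 0 (s + j) = m.real 0 (s + j)) :
    Cells S W m' s l := by
  intro j hj
  obtain ⟨h1, h2, h3⟩ := hm j hj
  rw [h1, h2, h3]
  exact h j hj

variable [MetricSpace X] {alg : StaticAlg X} {A M : ℕ} {S : PointStream X} {W : ℝ}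

attribute [local simp] wp NExp.val PExp.val RExp.val BExp.val Regs.state Regs.nat Regs.real
  Regs.pt Regs.setNat Regs.setReal Regs.setPt cellDist setCell_apply

theorem IsCenterFor.snoc {ι : Type*} {δ : ℝ} {p c : X} {l : List (ι × X)} {y : ι × X}
    (h : IsCenterFor δ p l c) (hy : δ < dist p y.2) : IsCenterFor δ p (l ++ [y]) c := by
  rcases h with ⟨y', hy', h⟩ | ⟨h, h'⟩
  · exact .inl ⟨y', by simp [hy'], h⟩
  · refine .inr ⟨h, fun y' hy' => ?_⟩
    rcases List.mem_append.1 hy' with hy' | hy'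
    · exact h' y' hy'
    · rwa [List.mem_singleton.1 hy']

/-- The center register starts with `p` itself and is overwritten at each match. It thus always
holds a legal center with respect to the prefix read so far. -/
theorem runs_find {m : Memory X} {R : Regs X} {p : X} {l : List (S.ι × X)}
    (hp : R.p = some p) (hc : R.c = some p) (hlast : R.last = R.src + l.length)
    (hcells : Cells S W m R.src l) :
    Runs alg A M (.loop srcGuard findBody) R m
      (l.length * (srcGuard.cost + 1 + findBody.steps) + (srcGuard.cost + 1))
      fun R' m' => m' = m ∧ ∃ x c, IsCenterFor R.δ p l c ∧
        R' = { R with src := x, c := some c } := by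
  refine (Runs.loop l.length (fun j R' m' => m' = m ∧ ∃ c, IsCenterFor R.δ p (l.take j) c ∧
    R' = { R with src := R.src + j, c := some c }) ?_ ?_ ?_).mono le_rfl ?_
  · exact ⟨rfl, p, .inr ⟨rfl, by simp⟩, by cases R; simp_all⟩
  · rintro j hj _ m' ⟨rfl, c, hc, rfl⟩
    refine ⟨by simp [srcGuard, hlast]; omega, ?_⟩
    have h1 := (hcells j hj).2.1
    rw [List.take_succ_eq_append_getElem hj]
    by_cases hd : dist p l[j].2 ≤ R.δ
    · refine Runs.of_wp_eq { R with src := R.src + (j + 1), c := some l[j].2 } m' ?_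
        ⟨rfl, _, .inl ⟨l[j], List.mem_append_right _ (List.mem_singleton_self _), rfl, hd⟩, rfl⟩
      simp [findBody, srcNext, h1, hp, hd, add_assoc]
    · refine Runs.of_wp_eq { R with src := R.src + (j + 1), c := some c } m' ?_
        ⟨rfl, _, hc.snoc (not_le.1 hd), rfl⟩
      simp [findBody, srcNext, h1, hp, hd, add_assoc]
  · rintro _ _ ⟨rfl, c, hc, rfl⟩
    simp [srcGuard, hlast]
  · rintro _ _ ⟨rfl, c, hc, rfl⟩
    exact ⟨rfl, _, c, by simpa using hc, rfl⟩

theorem runs_count {m : Memory X} {R : Regs X} {c : X} {l : List (S.ι × X)}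
    (hc : R.c = some c) (hcnt : R.cnt = 0) (hlast : R.last = R.src + l.length)
    (hcells : Cells S W m R.src l) :
    Runs alg A M (.loop srcGuard countBody) R m
      (l.length * (srcGuard.cost + 1 + countBody.steps) + (srcGuard.cost + 1))
      fun R' m' => m' = m ∧ ∃ x, R' = { R with src := x, cnt := l.countP (inGroup c) } := by
  refine (Runs.loop l.length (fun j R' m' => m' = m ∧
    R' = { R with src := R.src + j, cnt := (l.take j).countP (inGroup c) }) ?_ ?_ ?_).mono le_rfl ?_
  · exact ⟨rfl, by cases R; simp_all⟩
  · rintro j hj _ m' ⟨rfl, rfl⟩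
    refine ⟨by simp [srcGuard, hlast]; omega, ?_⟩
    have h1 := (hcells j hj).2.1
    rw [List.take_succ_eq_append_getElem hj, List.countP_append, List.countP_singleton]
    refine Runs.of_wp_eq _ m' ?_ ⟨rfl, rfl⟩
    by_cases hd : l[j].2 = c
    · simp [countBody, srcInGroup, srcNext, h1, hc, hd, add_assoc]
    · simp [countBody, srcInGroup, srcNext, h1, hc, hd, Ne.symm hd, add_assoc]
  · rintro _ _ ⟨rfl, rfl⟩
    simp [srcGuard, hlast]
  · rintro _ _ ⟨rfl, rfl⟩
    exact ⟨rfl, _, by rw [List.take_length]⟩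

/-- The entries that are kept in the given mode. -/
noncomputable def kept {ι : Type*} (mode : ℕ) (c : X) (l : List (ι × X)) : List (ι × X) :=
  if mode = 1 then l.eraseP (inGroup c) else l

/-- The list is compacted in place; since the target never overtakes the source, unread cells stay
intact. The address hypotheses are restricted to nonempty lists because the start pointer of an
empty level may lie outside its block, for example in blank memory. -/
theorem runs_copy {m : Memory X} {R : Regs X} {c : X} {l : List (S.ι × X)} (hA : 2 ≤ A)
    (hc : R.c = some c) (hlast : R.last = R.src + l.length) (hmode : R.mode ≤ 1)
    (hle : l ≠ [] → R.dst ≤ R.src) (hM : l ≠ [] → R.src + l.length ≤ M)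
    (hcells : Cells S W m R.src l) :
    Runs alg A M (.loop srcGuard copyBody) R m
      (l.length * (srcGuard.cost + 1 + copyBody.steps) + (srcGuard.cost + 1))
      fun R' m' => (∃ x y, R' = { R with
          src := x, dst := R.dst + (kept R.mode c l).length, mode := y }) ∧
        Cells S W m' R.dst (kept R.mode c l) ∧ m'.nat = m.nat ∧
        (∀ a ≠ 0, m'.real a = m.real a) ∧
        ∀ x, ¬ (R.dst ≤ x ∧ x < R.dst + (kept R.mode c l).length) →
          m'.pt 0 x = m.pt 0 x ∧ m'.pt 1 x = m.pt 1 x ∧ m'.real 0 x = m.real 0 x := by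
  refine (Runs.loop l.length (fun j R' m' => ∃ w : List (S.ι × X), w.length ≤ j ∧
    (∃ y ≤ 1, kept R.mode c l = w ++ kept y c (l.drop j) ∧
      R' = { R with src := R.src + j, dst := R.dst + w.length, mode := y }) ∧
    Cells S W m' R.dst w ∧ m'.nat = m.nat ∧ (∀ a ≠ 0, m'.real a = m.real a) ∧
    ∀ x, ¬ (R.dst ≤ x ∧ x < R.dst + w.length) →
      m'.pt 0 x = m.pt 0 x ∧ m'.pt 1 x = m.pt 1 x ∧ m'.real 0 x = m.real 0 x)
    ?_ ?_ ?_).mono le_rfl ?_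
  · refine ⟨[], le_rfl, ⟨R.mode, hmode, by simp, by simp⟩, fun j hj => by simp at hj, rfl,
      fun _ _ => rfl, fun _ _ => ⟨rfl, rfl, rfl⟩⟩
  · rintro j hj _ m' ⟨w, hw, ⟨y, hy, hkept, rfl⟩, hcw, hnat, hreal, hsame⟩
    have hne : l ≠ [] := by rintro rfl; simp at hj
    have hle := hle hne
    have hM := hM hne
    refine ⟨by simp [srcGuard, hlast]; omega, ?_⟩
    obtain ⟨h0, h1, h2⟩ := hcells j hj
    obtain ⟨g0, g1, g2⟩ := hsame (R.src + j) (by omega)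
    rw [h0] at g0
    rw [h1] at g1
    rw [h2] at g2
    have hdrop : l.drop j = l[j] :: l.drop (j + 1) := List.drop_eq_getElem_cons hj
    by_cases hskip : y = 1 ∧ l[j].2 = c
    · obtain ⟨rfl, hd⟩ := hskip
      refine Runs.of_wp_eq { R with src := R.src + (j + 1), dst := R.dst + w.length, mode := 0 } m'
        ?_ ⟨w, by omega, ⟨0, by omega, ?_, rfl⟩, hcw, hnat, hreal, hsame⟩
      · simp only [copyBody, srcInGroup, srcNext, wp]
        simp [g1, hc, hd, add_assoc]
      · rw [hkept, kept, if_pos rfl, hdrop, List.eraseP_cons_of_pos (inGroup_iff.2 hd)]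
        rfl
    · have hskip' : ¬ (1 ≤ y ∧ dist c l[j].2 ≤ 0) := by
        rintro ⟨h, h'⟩
        exact hskip ⟨by omega, (dist_le_zero.1 h').symm⟩
      have hdst : R.dst + w.length < M := by omega
      have hA0 : 0 < A := by omega
      have hA1 : 1 < A := by omega
      refine Runs.of_wp_eq
        { R with src := R.src + (j + 1), dst := R.dst + (w ++ [l[j]]).length, mode := y }
        { m' with
          pt := setCell (setCell m'.pt 0 (R.dst + w.length) (some (S.pt l[j].1)))
            1 (R.dst + w.length) (some l[j].2)
          real := setCell m'.real 0 (R.dst + w.length) (S.arr l[j].1 + W) }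
        ?_ ⟨w ++ [l[j]], by simp; omega, ⟨y, hy, ?_, rfl⟩, ?_, hnat, ?_, ?_⟩
      · simp only [copyBody, srcInGroup, srcNext, wp]
        constructor
        · intro h
          exact absurd (by simpa [g1, hc] using h) hskip'
        · intro _
          simp [g0, g1, g2, hdst, hA0, hA1, add_assoc]
      · rw [hkept, hdrop, List.append_assoc]
        congr 1
        unfold kept
        split_ifs with hy1
        · rw [List.eraseP_cons_of_neg (by simpa [inGroup] using fun h => hskip ⟨hy1, h⟩)]
          rfl
        · rfl
      · refine Cells.snoc (hcw.congr fun j' hj' => ?_) ?_ ?_ ?_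
        · simp [setCell_apply, hj'.ne]
        all_goals simp [setCell_apply]
      · intro a ha
        funext x
        simp [ha, hreal a ha]
      · intro x hx
        simp only [List.length_append, List.length_singleton] at hx
        have := hsame x (by omega)
        have hx' : x ≠ R.dst + w.length := by omega
        simpa [hx'] using this
  · rintro _ _ ⟨w, hw, ⟨y, hy, hkept, rfl⟩, -⟩
    simp [srcGuard, hlast]
  · rintro _ _ ⟨w, hw, ⟨y, hy, hkept, rfl⟩, h⟩
    have : kept R.mode c l = w := by
      rw [hkept]; simp [kept]
    rw [this]
    exact ⟨⟨_, _, rfl⟩, h⟩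

/-- Nothing is moved yet. An eviction for lack of space skips the first entry by advancing `src`; a
full group is handled by mode `1`, which tells the copying loop to omit one member. In all cases one
slot is left for the new entry. -/
theorem runs_discard {m : Memory X} {R : Regs X} {c : X} {l : List (S.ι × X)} {e : Option ℝ}
    (a : S.ι) (hA : 3 ≤ A) (hM : R.lvl < M) (hcap : 1 ≤ R.cap)
    (hrep : LevelRep S W R.cap m R.lvl l e) (hlen : l.length ≤ R.cap)
    (hcnt : R.cnt = l.countP (inGroup c)) (hlast : R.last = m.nat 1 R.lvl) :
    Runs alg A M discard R m discard.steps fun R' m' =>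
      ∃ x mode lc e', R' = { R with src := x, dst := R.base, mode := mode } ∧ mode ≤ 1 ∧
        R.last = x + lc.length ∧ Cells S W m' x lc ∧ lc.length ≤ R.cap ∧
        (lc ≠ [] → R.lvl * R.cap ≤ x ∧ x + lc.length ≤ (R.lvl + 1) * R.cap) ∧
        (kept mode c lc).length < R.cap ∧
        Inserts S W R.z R.cap a c l e (kept mode c lc ++ [(a, c)]) e' ∧
        (e' = none → m'.nat 2 R.lvl = 0) ∧
        (∀ e₀, e' = some e₀ → m'.nat 2 R.lvl = 1 ∧ m'.real 1 R.lvl = e₀) ∧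
        m'.real 2 = m.real 2 ∧ SameOff R.cap R.lvl m m' := by
  have hs := hrep.last
  have hA1 : 1 < A := by omega
  have hA2 : 2 < A := by omega
  have hrange : l ≠ [] → R.lvl * R.cap ≤ m.nat 0 R.lvl ∧
      m.nat 0 R.lvl + l.length ≤ (R.lvl + 1) * R.cap := fun hne => by
    have hpos := List.length_pos_iff.2 hne
    have h1 := (hrep.range 0 hpos).1
    have h2 := (hrep.range (l.length - 1) (by omega)).2
    omega
  by_cases hz : R.z + 1 ≤ R.cnt
  · refine Runs.of_wp_eq { R with src := m.nat 0 R.lvl, dst := R.base, mode := 1 } m ?_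
      ⟨_, 1, l, e, rfl, le_rfl, by rw [hlast, hs], hrep.cells, hlen, hrange, ?_,
        ⟨_, rfl, .inl ⟨by omega, if_pos rfl, rfl⟩⟩, hrep.flag_none, hrep.flag_some, rfl,
        ⟨fun _ _ => ⟨rfl, rfl, rfl⟩, fun _ _ => ⟨rfl, rfl⟩, fun _ _ => ⟨rfl, rfl, rfl⟩⟩⟩
    · simp only [discard, srcNext, wp]
      simp [hz]
    · obtain ⟨b, hb, hbc⟩ := List.countP_pos_iff.1 (show 0 < l.countP (inGroup c) by omega)
      rw [kept, if_pos rfl, List.length_eraseP_of_mem hb hbc]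
      omega
  · by_cases hfull : R.cap ≤ l.length
    · obtain ⟨b, l₀, rfl⟩ := List.exists_cons_of_length_pos (show 0 < l.length by omega)
      have hcell := hrep.cells 0 (by simp)
      have hr := hrange (by simp)
      simp only [List.length_cons, List.getElem_cons_zero, add_zero] at *
      refine Runs.of_wp_eq { R with src := m.nat 0 R.lvl + 1, dst := R.base, mode := 0 }
        { m with nat := setCell m.nat 2 R.lvl 1,
                 real := setCell m.real 1 R.lvl (S.arr b.1 + W) } ?_
        ⟨_, 0, l₀, some (S.arr b.1 + W), rfl, by omega, by omega, ?_, by omega, ?_, ?_,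
          ⟨_, rfl, .inr (.inl ⟨by omega, hfull, b, rfl, rfl⟩)⟩, by simp, ?_, ?_, ?_, ?_, ?_⟩
      · simp only [discard, srcNext, wp]
        have : R.cap ≤ R.last - m.nat 0 R.lvl := by omega
        simp [hz, this, hA1, hA2, hM, hcell.2.2]
      · intro j hj
        have := hrep.cells (j + 1) (by simpa using hj)
        simpa [setCell_apply, add_assoc, add_comm 1 j] using this
      · intro _
        omega
      · change l₀.length < _
        omega
      · intro e₀ he
        simpa [setCell_apply] using he
      · funext x
        simp [setCell_apply]
      · intro i' hi
        simp [setCell_apply, hi]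
      · intro i' hi
        simp [setCell_apply, hi]
      · intro j _
        simp [setCell_apply]
    · refine Runs.of_wp_eq { R with src := m.nat 0 R.lvl, dst := R.base, mode := 0 } m ?_
        ⟨_, 0, l, e, rfl, by omega, by rw [hlast, hs], hrep.cells, hlen, hrange, not_le.1 hfull,
          ⟨_, rfl, .inr (.inr ⟨by omega, not_le.1 hfull, rfl, rfl⟩)⟩, hrep.flag_none,
          hrep.flag_some, rfl,
          ⟨fun _ _ => ⟨rfl, rfl, rfl⟩, fun _ _ => ⟨rfl, rfl⟩, fun _ _ => ⟨rfl, rfl, rfl⟩⟩⟩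
      simp only [discard, srcNext, wp]
      have : ¬ R.cap ≤ R.last - m.nat 0 R.lvl := by omega
      simp [hz, this]

theorem runs_levelArrive {m : Memory X} {R : Regs X} {l : List (S.ι × X)} {e : Option ℝ}
    (a : S.ι) (hA : 3 ≤ A) (hlvl : R.lvl < M) (hM : (R.lvl + 1) * R.cap ≤ M) (hcap : 1 ≤ R.cap)
    (hbase : R.base = R.lvl * R.cap) (hp : R.p = some (S.pt a)) (ht : R.time = S.arr a)
    (hW : R.W = W) (hrep : LevelRep S W R.cap m R.lvl l e) (hlen : l.length ≤ R.cap) :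
    Runs alg A M levelArrive R m (100 * (R.cap + 1)) fun R' m' =>
      (∃ x y u v w c, R' = { R with src := x, dst := y, cnt := u, mode := v, last := w, c := c }) ∧
      (∃ c l' e', IsCenterFor R.δ (S.pt a) l c ∧ Inserts S W R.z R.cap a c l e l' e' ∧
        LevelRep S W R.cap m' R.lvl l' e') ∧
      m'.real 2 R.lvl = R.δ + R.δ ∧ SameOff R.cap R.lvl m m' := by
  have hA0 : 0 < A := by omega
  have hA1 : 1 < A := by omega
  have hA2 : 2 < A := by omega
  set m₁ : Memory X := { m with real := setCell m.real 2 R.lvl (R.δ + R.δ) } with hm₁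
  have hrep₁ : LevelRep S W R.cap m₁ R.lvl l e := by
    refine ⟨hrep.last, hrep.range, hrep.cells.congr fun j _ => ?_, hrep.flag_none, ?_⟩
    · simp [m₁, setCell_apply]
    · simpa [m₁, setCell_apply] using hrep.flag_some
  have hs₁ : SameOff R.cap R.lvl m m₁ := by
    refine ⟨fun _ _ => ⟨rfl, rfl, rfl⟩, fun i' hi => ?_, fun j _ => ?_⟩
    · simp [m₁, setCell_apply, hi]
    · simp [m₁, setCell_apply]
  have hlast := hrep₁.last
  have key : Runs alg A M levelArrive R m
      (levelInit.steps + ((l.length * (srcGuard.cost + 1 + findBody.steps) + (srcGuard.cost + 1)) +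
        (countInit.steps + ((l.length * (srcGuard.cost + 1 + countBody.steps) +
          (srcGuard.cost + 1)) + (discard.steps +
            ((R.cap * (srcGuard.cost + 1 + copyBody.steps) + (srcGuard.cost + 1)) +
              append.steps)))))) fun R' m' =>
      (∃ x y u v w c, R' = { R with src := x, dst := y, cnt := u, mode := v, last := w, c := c }) ∧
      (∃ c l' e', IsCenterFor R.δ (S.pt a) l c ∧ Inserts S W R.z R.cap a c l e l' e' ∧
        LevelRep S W R.cap m' R.lvl l' e') ∧
      m'.real 2 R.lvl = R.δ + R.δ ∧ SameOff R.cap R.lvl m m' := by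
    refine Runs.seq (Q₁ := fun R' m' => R' = { R with
      src := m₁.nat 0 R.lvl, last := m₁.nat 1 R.lvl, c := some (S.pt a) } ∧ m' = m₁) (Runs.of_wp ?_) ?_
    · simp only [levelInit, wp]
      simp [hA2, hlvl, hp, m₁]
    rintro _ _ ⟨rfl, rfl⟩
    refine Runs.seq (runs_find (p := S.pt a) (l := l) hp rfl hlast hrep₁.cells) ?_
    rintro _ _ ⟨rfl, x, c, hc, rfl⟩
    refine Runs.seq (Q₁ := fun R' m' => R' = { R with
      src := m₁.nat 0 R.lvl, cnt := 0, last := m₁.nat 1 R.lvl, c := some c } ∧ m' = m₁) (Runs.of_wp ?_) ?_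
    · simp only [countInit, wp]
      simp
    rintro _ _ ⟨rfl, rfl⟩
    refine Runs.seq (runs_count (c := c) (l := l) rfl rfl hlast hrep₁.cells) ?_
    rintro _ _ ⟨rfl, x, rfl⟩
    refine Runs.seq (runs_discard (c := c) (l := l) (e := e) a hA hlvl hcap hrep₁ hlen rfl rfl) ?_
    rintro _ m₂ ⟨x, mode, lc, e', rfl, hmode, hlast₂, hcells₂, hlc, hrange, hkept, hins, hfn, hfs,
      hreal₂, hs₂⟩
    dsimp only at *
    refine Runs.seq ((runs_copy (c := c) (l := lc) (by omega) rfl hlast₂ hmode ?_ ?_ hcells₂).mono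
      (Nat.add_le_add_right (Nat.mul_le_mul_right _ hlc) _) fun _ _ h => h) ?_
    · intro h
      dsimp only
      rw [hbase]
      exact (hrange h).1
    · intro h
      exact (hrange h).2.trans hM
    rintro _ m₃ ⟨⟨x, y, rfl⟩, hcells₃, hnat₃, hreal₃, hsame₃⟩
    dsimp only at *
    set T := kept mode c lc with hT
    -- The appended entry still lies in the block of this level, so the other levels are untouched.
    have hend : R.base + T.length < (R.lvl + 1) * R.cap := by
      rw [hbase, Nat.succ_mul]; omega
    have hdst : R.base + T.length < M := hend.trans_le hM
    refine Runs.of_wp_eq { R with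
      src := x, dst := R.base + T.length, cnt := l.countP (inGroup c), mode := y,
      last := m₁.nat 1 R.lvl, c := some c } ⟨setCell (setCell m₃.nat 0 R.lvl R.base) 1 R.lvl (R.base + T.length + 1),
      setCell m₃.real 0 (R.base + T.length) (S.arr a + W),
      setCell (setCell m₃.pt 0 (R.base + T.length) (some (S.pt a))) 1 (R.base + T.length)
        (some c)⟩ ?_ ⟨⟨_, _, _, _, _, _, rfl⟩, ⟨c, _, e', hc, hins, ?_⟩, ?_, hs₁.trans (hs₂.trans ?_)⟩
    · simp only [append, wp]
      simp [hA0, hA1, hlvl, hdst, hp, ht, hW]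
    · refine ⟨?_, ?_, ?_, ?_, ?_⟩
      · simp [setCell_apply, add_assoc]
      · intro j hj
        simp only [List.length_append, List.length_singleton] at hj
        simp [setCell_apply]
        omega
      · have hb : setCell (setCell m₃.nat 0 R.lvl R.base) 1 R.lvl (R.base + T.length + 1) 0 R.lvl =
            R.base := by simp [setCell_apply]
        dsimp only
        rw [hb]
        refine Cells.snoc (hcells₃.congr fun j hj => ?_) ?_ ?_ ?_
        · simp [setCell_apply, hj.ne]
        all_goals simp [setCell_apply]
      · simpa [setCell_apply, hnat₃] using hfn
      · simpa [setCell_apply, hnat₃, hreal₃] using hfs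
    · simp [setCell_apply, hreal₃, hreal₂, m₁]
    · refine ⟨fun i' hi => ?_, fun i' hi => ?_, fun j hj => ?_⟩
      · simp [setCell_apply, hi, hnat₃]
      · simp [setCell_apply, hreal₃]
      · have h1 := hsame₃ j (by omega)
        have h2 : j ≠ R.base + T.length := by
          have := hbase; omega
        simpa [setCell_apply, h2] using h1
  have h₁ := Nat.mul_le_mul_right (srcGuard.cost + 1 + findBody.steps) hlen
  have h₂ := Nat.mul_le_mul_right (srcGuard.cost + 1 + countBody.steps) hlen
  refine key.mono ?_ fun _ _ h => h
  simp only [levelInit, countInit, discard, append, findBody, countBody, copyBody, srcGuard, srcNext,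
    srcInGroup, Prog.steps, BExp.cost, NExp.cost, PExp.cost, RExp.cost] at h₁ h₂ ⊢
  omega

end LevelProgram

/-! ## The programs -/

section Programs

/-- Discard the oldest entry of the current level if it has expired. -/
def dropExpired : Prog :=
  .ite (.and (.nle (.add (.load 0 (.reg 4)) (.lit 1)) (.load 1 (.reg 4)))
      (.rle (.load 0 (.load 0 (.reg 4))) (.reg 0)))
    (.storeN 0 (.reg 4) (.add (.load 0 (.reg 4)) (.lit 1))) .skip

/-- Select the current level for reporting if it is valid. -/
def selectLevel : Prog :=
  .ite (.and (.nle (.lit 1) (.load 2 (.reg 4))) (.not (.rle (.load 1 (.reg 4)) (.reg 0)))) .skip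
    (.seq (.storeN 4 (.lit 0) (.load 0 (.reg 4)))
      (.seq (.storeN 5 (.lit 0) (.sub (.load 1 (.reg 4)) (.load 0 (.reg 4))))
        (.storeR 3 (.lit 0) (.load 2 (.reg 4)))))

/-- The program for departures: from the last level down to the first one, discard the expired
entry and select the level if it is valid. -/
def refresh : Prog :=
  .seq (.setN 4 (.load 6 (.lit 0)))
    (.loop (.nle (.lit 1) (.reg 4))
      (.seq (.setN 4 (.sub (.reg 4) (.lit 1))) (.seq dropExpired selectLevel)))

/-- The program that reports a solution. -/
def report : Prog :=
  .seq (.call 0 (.load 4 (.lit 0)) (.lit 1) (.load 5 (.lit 0)) 0)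
    (.setR 0 (.add (.reg 0) (.load 3 (.lit 0))))

/-- Multiplication by a constant. -/
def mulLit (e : NExp) : ℕ → NExp
  | 0 => .lit 0
  | n + 1 => .add (mulLit e n) e

/-- The test for another multiplication in the computation of the capacity. -/
def powGuard (B : ℕ) : BExp :=
  .and (.nle (.lit 2) (.lit B)) (.not (.rle (.lit 10) (.mul (.reg 7) (.reg 2))))

/-- One multiplication in the computation of the capacity. -/
def powBody (B : ℕ) : Prog :=
  .seq (.setR 7 (.mul (.lit 2) (.reg 7))) (.setN 2 (mulLit (.reg 2) B))

/-- One addition in the computation of the capacity. -/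
def sumBody : Prog := .seq (.setN 3 (.add (.reg 3) (.reg 2))) (.setN 6 (.add (.reg 6) (.lit 1)))

/-- The computation of the capacity of a level. -/
def computeCap (B : ℕ) : Prog :=
  .seq (.seq (.setN 2 (.reg 0)) (.setR 7 (.lit 1)))
    (.seq (.loop (powGuard B) (powBody B))
      (.seq (.seq (.setN 3 (.reg 1)) (.setN 6 (.lit 0))) (.loop (.nle (.reg 6) (.reg 1)) sumBody)))

/-- Pass to the next level. -/
def nextLevel : Prog :=
  .seq (.setN 4 (.add (.reg 4) (.lit 1))) (.seq (.setN 5 (.add (.reg 5) (.reg 3)))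
    (.seq (.setR 5 (.mul (.lit 2) (.reg 5))) (.setR 6 (.div (.mul (.reg 2) (.reg 5)) (.lit 8)))))

/-- The arrival of a point at all levels. -/
def arriveLevels : Prog :=
  .seq (.seq (.setN 4 (.lit 0)) (.seq (.setN 5 (.lit 0)) (.seq (.setR 5 (.reg 3))
      (.setR 6 (.lit 0)))))
    (.seq (.loop (.rle (.reg 5) (.mul (.lit 4) (.reg 4))) (.seq levelArrive nextLevel))
      (.storeN 6 (.lit 0) (.reg 4)))

/-- The program for arrivals. -/
def arrive (B : ℕ) : Prog := .seq (computeCap B) (.seq arriveLevels refresh)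

/-- The sketching algorithm. -/
def sketchAlg (B : ℕ) : SketchAlg := ⟨arrive B, refresh, report⟩

variable {X : Type u}

theorem LevelRep.of_eq {S : PointStream X} {W : ℝ} {cap i : ℕ} {m m' : Memory X}
    {l : List (S.ι × X)} {e : Option ℝ} (h : LevelRep S W cap m i l e)
    (h0 : m'.nat 0 i = m.nat 0 i) (h1 : m'.nat 1 i = m.nat 1 i) (h2 : m'.nat 2 i = m.nat 2 i)
    (hr0 : m'.real 0 = m.real 0) (hr1 : m'.real 1 = m.real 1) (hp : m'.pt = m.pt) :
    LevelRep S W cap m' i l e := by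
  refine ⟨by rw [h1, h0, h.last], by rw [h0]; exact h.range, ?_, by rw [h2]; exact h.flag_none,
    by rw [h2, hr1]; exact h.flag_some⟩
  rw [h0]
  exact h.cells.congr fun j _ => by rw [hp, hr0]; exact ⟨rfl, rfl, rfl⟩

theorem cellRange_eq {S : PointStream X} {W : ℝ} {m : Memory X} {s : ℕ} {l : List (S.ι × X)}
    (h : Cells S W m s l) : cellRange (m.pt 0) s 1 l.length = l.map fun y => S.pt y.1 := by
  unfold cellRange
  induction l using List.reverseRecOn with
  | nil => rfl
  | append_singleton l y ih =>
    have h1 := h l.length (by simp)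
    simp only [List.getElem_concat_length] at h1
    rw [List.length_append, List.length_singleton, List.range_succ, List.filterMap_append, ih]
    · simp [h1.1]
    · intro j hj
      have := h j (by simp; omega)
      rwa [List.getElem_append_left hj] at this

/-- A level with discarding time `e` is valid at time `t`. -/
def Valid (t : ℝ) (e : Option ℝ) : Prop := ∀ e₀, e = some e₀ → e₀ ≤ t

/-- The memory describes the list `l` and the additional radius `x` for reporting. -/
def Selected (S : PointStream X) (m : Memory X) (l : List (S.ι × X)) (x : ℝ) : Prop :=
  cellRange (m.pt 0) (m.nat 4 0) 1 (m.nat 5 0) = (l.map fun y => S.pt y.1) ∧ m.real 3 0 = x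

theorem mulLit_val (s : State X) (e : NExp) (n : ℕ) : (mulLit e n).val s = n * e.val s := by
  induction n with
  | zero => simp [mulLit, NExp.val]
  | succ n ih => rw [mulLit, NExp.val, ih, Nat.succ_mul]

theorem mulLit_cost (x n : ℕ) : (mulLit (.reg x) n).cost = 2 * n + 1 := by
  induction n with
  | zero => rfl
  | succ n ih => rw [mulLit, NExp.cost, ih, NExp.cost]; omega

variable [MetricSpace X] {alg : StaticAlg X} {A M : ℕ} {S : PointStream X} {W : ℝ}

attribute [local simp] wp NExp.val PExp.val RExp.val BExp.val Regs.state Regs.nat Regs.real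
  Regs.pt Regs.setNat Regs.setReal Regs.setPt cellDist setCell_apply

theorem runs_dropExpired {m : Memory X} {R : Regs X} {cap : ℕ} {l : List (S.ι × X)}
    {e : Option ℝ} (hA : 0 < A) (hM : R.lvl < M) (hrep : LevelRep S W cap m R.lvl l e) :
    Runs alg A M dropExpired R m dropExpired.steps fun R' m' => R' = R ∧
      LevelRep S W cap m' R.lvl (expire S W R.time l) e ∧ m'.pt = m.pt ∧ m'.real = m.real ∧
      ∀ a i, a ≠ 0 ∨ i ≠ R.lvl → m'.nat a i = m.nat a i := by
  have hl := hrep.last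
  cases l with
  | nil =>
    refine Runs.of_wp_eq R m ?_ ⟨rfl, hrep, rfl, rfl, fun _ _ _ => rfl⟩
    simp at hl
    simp [dropExpired, hl]
  | cons y l =>
    have hcell := (hrep.cells 0 (by simp)).2.2
    simp at hl hcell
    rw [expire]
    by_cases hy : S.arr y.1 + W ≤ R.time
    · rw [if_pos hy]
      refine Runs.of_wp_eq R { m with nat := setCell m.nat 0 R.lvl (m.nat 0 R.lvl + 1) } ?_
        ⟨rfl, ⟨?_, ?_, ?_, ?_, ?_⟩, rfl, rfl, fun a i h => ?_⟩
      · simp [dropExpired, hl, hcell, hy, hA, hM, ← add_assoc]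
      · simp [hl]; omega
      · intro j hj
        have := hrep.range (j + 1) (by simpa using hj)
        simp; omega
      · intro j hj
        have := hrep.cells (j + 1) (by simpa using hj)
        simpa [add_assoc, add_comm 1 j] using this
      · simpa using hrep.flag_none
      · simpa using hrep.flag_some
      · rcases h with h | h <;> simp [h]
    · rw [if_neg hy]
      refine Runs.of_wp_eq R m ?_ ⟨rfl, hrep, rfl, rfl, fun _ _ _ => rfl⟩
      simp [dropExpired, hl, hcell, hy]

theorem runs_selectLevel {m : Memory X} {R : Regs X} {cap : ℕ} {l : List (S.ι × X)}
    {e : Option ℝ} (hA : 6 ≤ A) (hM : R.lvl < M) (hrep : LevelRep S W cap m R.lvl l e) :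
    Runs alg A M selectLevel R m selectLevel.steps fun R' m' => R' = R ∧ m'.pt = m.pt ∧
      (∀ a ≠ 3, m'.real a = m.real a) ∧ (∀ a, a ≠ 4 → a ≠ 5 → m'.nat a = m.nat a) ∧
      ((¬ Valid R.time e ∧ m' = m) ∨ (Valid R.time e ∧ Selected S m' l (m.real 2 R.lvl))) := by
  have hA3 : 3 < A := by omega
  have hA4 : 4 < A := by omega
  have hA5 : 5 < A := by omega
  have hM0 : 0 < M := by omega
  by_cases hv : Valid R.time e
  · have hcond : ¬ (1 ≤ m.nat 2 R.lvl ∧ ¬ m.real 1 R.lvl ≤ R.time) := by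
      rintro ⟨h1, h2⟩
      rcases e with _ | e₀
      · have := hrep.flag_none rfl
        omega
      · rw [(hrep.flag_some e₀ rfl).2] at h2
        exact h2 (hv e₀ rfl)
    refine Runs.of_wp_eq R { m with
      nat := setCell (setCell m.nat 4 0 (m.nat 0 R.lvl)) 5 0 l.length
      real := setCell m.real 3 0 (m.real 2 R.lvl) } ?_ ⟨rfl, rfl, ?_, ?_, .inr ⟨hv, ?_, ?_⟩⟩
    · simp only [selectLevel, wp]
      refine ⟨fun h => absurd (by simpa using h) hcond, fun _ => ?_⟩
      simp [hA3, hA4, hA5, hM0, hrep.last]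
    · intro a ha
      funext x
      simp [ha]
    · intro a h4 h5
      funext x
      simp [h4, h5]
    · have := cellRange_eq hrep.cells
      simpa using this
    · simp
  · refine Runs.of_wp_eq R m ?_ ⟨rfl, rfl, fun _ _ => rfl, fun _ _ _ => rfl, .inl ⟨hv, rfl⟩⟩
    obtain ⟨e₀, rfl, he⟩ : ∃ e₀, e = some e₀ ∧ ¬ e₀ ≤ R.time := by simpa [Valid] using hv
    obtain ⟨h1, h2⟩ := hrep.flag_some e₀ rfl
    simp [selectLevel, h1, h2, not_le.1 he]

/-- Levels are visited downwards and each valid one overwrites the previous selection, so the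
smallest valid level remains. Point cells are not moved, which keeps an earlier selection readable.
-/
theorem runs_refresh {m : Memory X} {R : Regs X} {cap n : ℕ} {l : ℕ → List (S.ι × X)}
    {e : ℕ → Option ℝ} (hA : 6 ≤ A) (hn : n ≤ M) (hm : m.nat 6 0 = n)
    (hrep : ∀ i < n, LevelRep S W cap m i (l i) (e i)) :
    Runs alg A M refresh R m (100 * (n + 1)) fun _ m' =>
      (∀ i < n, LevelRep S W cap m' i (expire S W R.time (l i)) (e i)) ∧ m'.nat 6 = m.nat 6 ∧
      m'.real 2 = m.real 2 ∧
      ((∀ i < n, ¬ Valid R.time (e i)) ∨ ∃ i < n, Valid R.time (e i) ∧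
        (∀ i' < i, ¬ Valid R.time (e i')) ∧
        Selected S m' (expire S W R.time (l i)) (m.real 2 i)) := by
  have key := Runs.loop (alg := alg) (A := A) (M := M) (b := .nle (.lit 1) (.reg 4))
    (p := .seq (.setN 4 (.sub (.reg 4) (.lit 1))) (.seq dropExpired selectLevel))
    (R := { R with lvl := n }) (m := m)
    (n := (Prog.setN 4 (.sub (.reg 4) (.lit 1))).steps + (dropExpired.steps + selectLevel.steps))
    n (fun j R' m' => R' = { R with lvl := n - j } ∧
      m'.pt = m.pt ∧ (∀ a ≠ 3, m'.real a = m.real a) ∧ m'.nat 6 = m.nat 6 ∧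
      (∀ i < n - j, LevelRep S W cap m' i (l i) (e i)) ∧
      (∀ i, n - j ≤ i → i < n → LevelRep S W cap m' i (expire S W R.time (l i)) (e i)) ∧
      ((∀ i, n - j ≤ i → i < n → ¬ Valid R.time (e i)) ∨ ∃ i, n - j ≤ i ∧ i < n ∧
        Valid R.time (e i) ∧ (∀ i', n - j ≤ i' → i' < i → ¬ Valid R.time (e i')) ∧
        Selected S m' (expire S W R.time (l i)) (m.real 2 i))) ?_ ?_ ?_
  · refine (Runs.seq (Q₁ := fun R' m' => R' = { R with lvl := n } ∧ m' = m) (Runs.of_wp ?_)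
      (fun R' m' h => by obtain ⟨rfl, rfl⟩ := h; exact key)).mono ?_ ?_
    · simp [hm]
    · simp only [dropExpired, selectLevel, Prog.steps, BExp.cost, NExp.cost, RExp.cost]
      omega
    · rintro R' m' ⟨-, -, hreal, h6, -, hdone, hsel⟩
      rw [Nat.sub_self] at hdone hsel
      refine ⟨fun i hi => hdone i (Nat.zero_le _) hi, h6, hreal 2 (by norm_num), ?_⟩
      rcases hsel with h | ⟨i, -, hi, hv, hf, hs⟩
      · exact .inl fun i hi => h i (Nat.zero_le _) hi
      · exact .inr ⟨i, hi, hv, fun i' hi' => hf i' (Nat.zero_le _) hi', hs⟩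
  · refine ⟨rfl, rfl, fun _ _ => rfl, rfl, hrep, fun i h1 h2 => ?_, .inl fun i h1 h2 => ?_⟩ <;> omega
  · rintro j hj _ m₀ ⟨rfl, hpt, hreal, h6, htodo, hdone, hsel⟩
    refine ⟨by simp; omega, ?_⟩
    have hlt : n - (j + 1) < n - j := by omega
    refine Runs.seq (Q₁ := fun R' m' => R' = { R with lvl := n - (j + 1) } ∧ m' = m₀)
      (Runs.of_wp ?_) ?_
    · simp [Nat.sub_sub]
    rintro _ m₀ ⟨rfl, rfl⟩
    refine Runs.seq (runs_dropExpired (by omega) (by simp only; omega) (htodo _ hlt)) ?_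
    rintro _ m₁ ⟨rfl, hrep₁, hpt₁, hreal₁, hnat₁⟩
    refine (runs_selectLevel hA (by simp only; omega) hrep₁).mono le_rfl ?_
    rintro _ m₂ ⟨rfl, hpt₂, hreal₂, hnat₂, hcase⟩
    dsimp only at *
    have hnat : ∀ a i, a ≠ 4 → a ≠ 5 → i ≠ n - (j + 1) → m₂.nat a i = m₀.nat a i :=
      fun a i h4 h5 hi => by rw [hnat₂ a h4 h5, hnat₁ a i (.inr hi)]
    have hr : ∀ a ≠ 3, m₂.real a = m₀.real a := fun a ha => by rw [hreal₂ a ha, hreal₁]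
    have hkeep : ∀ {i l' e'}, i ≠ n - (j + 1) → LevelRep S W cap m₀ i l' e' →
        LevelRep S W cap m₂ i l' e' := fun hi h =>
      h.of_eq (hnat 0 _ (by norm_num) (by norm_num) hi) (hnat 1 _ (by norm_num) (by norm_num) hi)
        (hnat 2 _ (by norm_num) (by norm_num) hi) (hr 0 (by norm_num)) (hr 1 (by norm_num))
        (by rw [hpt₂, hpt₁])
    refine ⟨rfl, by rw [hpt₂, hpt₁, hpt], fun a ha => by rw [hr a ha, hreal a ha], ?_,
      fun i hi => hkeep (by omega) (htodo i (by omega)), fun i h1 h2 => ?_, ?_⟩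
    · rw [hnat₂ 6 (by norm_num) (by norm_num), ← h6]
      funext i
      exact hnat₁ 6 i (.inl (by norm_num))
    · rcases eq_or_ne i (n - (j + 1)) with rfl | hi
      · exact hrep₁.of_eq (by rw [hnat₂ 0 (by norm_num) (by norm_num)])
          (by rw [hnat₂ 1 (by norm_num) (by norm_num)])
          (by rw [hnat₂ 2 (by norm_num) (by norm_num)]) (hreal₂ 0 (by norm_num))
          (hreal₂ 1 (by norm_num)) hpt₂
      · exact hkeep hi (hdone i (by omega) h2)
    · rcases hcase with ⟨hv, rfl⟩ | ⟨hv, hs⟩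
      · have hstep : ∀ i', n - (j + 1) ≤ i' → i' = n - (j + 1) ∨ n - j ≤ i' := by omega
        rcases hsel with h | ⟨i, h1, h2, hvi, hf, hs⟩
        · refine .inl fun i h1 h2 => ?_
          rcases hstep i h1 with rfl | h1
          · exact hv
          · exact h i h1 h2
        · refine .inr ⟨i, by omega, h2, hvi, fun i' h1' h2' => ?_, ?_⟩
          · rcases hstep i' h1' with rfl | h1'
            · exact hv
            · exact hf i' h1' h2'
          · unfold Selected at hs ⊢
            rw [hpt₂, hpt₁, hnat₁ 4 0 (.inl (by norm_num)), hnat₁ 5 0 (.inl (by norm_num)), hreal₁]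
            exact hs
      · refine .inr ⟨n - (j + 1), le_rfl, by omega, hv, fun i' _ _ => by omega, ?_⟩
        rw [hreal₁, hreal 2 (by norm_num)] at hs
        exact hs
  · rintro _ m' ⟨rfl, -⟩
    simp

/-- Registers are not kept between events, so the capacity is recomputed at each arrival. Natural
numbers cannot be multiplied, so the factor `B` is unrolled into additions and the factor `z + 1`
becomes a loop. -/
theorem runs_computeCap {m : Memory X} {R : Regs X} {B J : ℕ}
    (hJ : ∀ j < J, 2 ≤ B ∧ (2 : ℝ) ^ j * R.ε < 10) (hJ' : 2 ≤ B → 10 ≤ (2 : ℝ) ^ J * R.ε) :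
    Runs alg A M (computeCap B) R m (100 * (J * (B + 1) + R.z + 1)) fun R' m' =>
      m' = m ∧ ∃ x y p, R' = { R with
        num := x, cap := R.k * B ^ J * (R.z + 1) + R.z, src := y, pow := p } := by
  have key : Runs alg A M (computeCap B) R m (4 +
      ((J * ((powGuard B).cost + 1 + (powBody B).steps) + ((powGuard B).cost + 1)) +
        (4 + ((R.z + 1) * (3 + 1 + sumBody.steps) + (3 + 1))))) fun R' m' =>
      m' = m ∧ ∃ x y p, R' = { R with
        num := x, cap := R.k * B ^ J * (R.z + 1) + R.z, src := y, pow := p } := by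
    refine Runs.seq (Q₁ := fun R' m' => R' = { R with num := R.k, pow := 1 } ∧ m' = m)
      (Runs.of_wp (by simp)) ?_
    rintro _ m ⟨rfl, rfl⟩
    refine Runs.seq (Runs.loop J (fun j R' m' => R' = { R with
      num := R.k * B ^ j, pow := 2 ^ j } ∧ m' = m) (by simp) ?_ ?_) ?_
    · rintro j hj _ m ⟨rfl, rfl⟩
      refine ⟨by simpa [powGuard] using hJ j hj, Runs.of_wp ?_⟩
      simp [powBody, mulLit_val, pow_succ, mul_comm, mul_left_comm]
    · rintro _ m ⟨rfl, rfl⟩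
      simpa [powGuard] using hJ'
    rintro _ m ⟨rfl, rfl⟩
    refine Runs.seq (Q₁ := fun R' m' => R' = { R with
      num := R.k * B ^ J, pow := 2 ^ J, cap := R.z, src := 0 } ∧ m' = m)
      (Runs.of_wp (by simp)) ?_
    rintro _ m ⟨rfl, rfl⟩
    refine (Runs.loop (R.z + 1) (fun j R' m' => R' = { R with
      num := R.k * B ^ J, pow := 2 ^ J, cap := R.z + R.k * B ^ J * j, src := j } ∧ m' = m)
      (by simp) ?_ ?_).mono le_rfl ?_
    · rintro j hj _ m ⟨rfl, rfl⟩
      refine ⟨by simp; omega, Runs.of_wp ?_⟩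
      simp [sumBody, mul_add, add_assoc]
    · rintro _ m ⟨rfl, rfl⟩
      simp
    · rintro _ m ⟨rfl, rfl⟩
      exact ⟨rfl, _, _, _, by rw [add_comm R.z]⟩
  refine key.mono ?_ fun _ _ h => h
  simp only [powGuard, powBody, sumBody, Prog.steps, BExp.cost, NExp.cost, RExp.cost, mulLit_cost]
  nlinarith

/-- The radius of a level. -/
noncomputable def levelRadius (ε Δ : ℝ) (i : ℕ) : ℝ := if i = 0 then 0 else ε * (2 ^ i * Δ) / 8

theorem runs_arriveLevels {m : Memory X} {R : Regs X} {n : ℕ} {l : ℕ → List (S.ι × X)}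
    {e : ℕ → Option ℝ} (a : S.ι) (hA : 7 ≤ A) (hcap : 1 ≤ R.cap) (hM : n * R.cap ≤ M)
    (hn : ∀ i < n, 2 ^ i * R.Δmin ≤ 4 * R.Δmax) (hn' : ¬ 2 ^ n * R.Δmin ≤ 4 * R.Δmax)
    (hn0 : 0 < n)
    (hp : R.p = some (S.pt a)) (ht : R.time = S.arr a) (hW : R.W = W)
    (hrep : ∀ i < n, LevelRep S W R.cap m i (l i) (e i)) (hlen : ∀ i < n, (l i).length ≤ R.cap) :
    Runs alg A M arriveLevels R m (200 * (n * (R.cap + 1) + 1)) fun R' m' =>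
      R'.time = S.arr a ∧ m'.nat 6 0 = n ∧ ∀ i < n, ∃ c l' e',
        IsCenterFor (levelRadius R.ε R.Δmin i) (S.pt a) (l i) c ∧
        Inserts S W R.z R.cap a c (l i) (e i) l' e' ∧ LevelRep S W R.cap m' i l' e' ∧
        m'.real 2 i = levelRadius R.ε R.Δmin i + levelRadius R.ε R.Δmin i := by
  have hnM : n ≤ M := by nlinarith
  set P : ℕ → Memory X → Prop := fun i m' => ∃ c l' e',
    IsCenterFor (levelRadius R.ε R.Δmin i) (S.pt a) (l i) c ∧
    Inserts S W R.z R.cap a c (l i) (e i) l' e' ∧ LevelRep S W R.cap m' i l' e' ∧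
    m'.real 2 i = levelRadius R.ε R.Δmin i + levelRadius R.ε R.Δmin i with hP
  have key : Runs alg A M arriveLevels R m (8 +
      ((n * (5 + 1 + (100 * (R.cap + 1) + nextLevel.steps)) + (5 + 1)) + 3)) fun R' m' =>
      R'.time = S.arr a ∧ m'.nat 6 0 = n ∧ ∀ i < n, P i m' := by
    refine Runs.seq (Q₁ := fun R' m' => R' = { R with
      lvl := 0, base := 0, scale := R.Δmin, δ := 0 } ∧ m' = m) (Runs.of_wp (by simp)) ?_
    rintro _ m ⟨rfl, rfl⟩
    refine Runs.seq (Runs.loop n (fun j R' m' => (∃ x y u v w c, R' = { R with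
      lvl := j, base := j * R.cap, scale := 2 ^ j * R.Δmin, δ := levelRadius R.ε R.Δmin j,
      src := x, dst := y, cnt := u, mode := v, last := w, c := c }) ∧
      (∀ i < j, P i m') ∧ ∀ i, j ≤ i → i < n → LevelRep S W R.cap m' i (l i) (e i)) ?_ ?_ ?_) ?_
    · exact ⟨⟨R.src, R.dst, R.cnt, R.mode, R.last, R.c, by simp [levelRadius]⟩, by simp,
        fun i _ hi => hrep i hi⟩
    · rintro j hj _ m ⟨⟨x, y, u, v, w, c, rfl⟩, hdone, htodo⟩
      refine ⟨by simpa using hn j hj, ?_⟩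
      refine Runs.seq (runs_levelArrive (S := S) (W := W) (l := l j) (e := e j) a (by omega)
        (by simp only; omega) ((Nat.mul_le_mul_right _ hj).trans hM) hcap rfl hp ht hW
        (htodo j le_rfl hj) (hlen j hj)) ?_
      rintro _ m' ⟨⟨x, y, u, v, w, c, rfl⟩, ⟨c', l', e', hc, hins, hrep'⟩, hreal, hsame⟩
      dsimp only at *
      refine Runs.of_wp_eq { R with
        lvl := j + 1, base := (j + 1) * R.cap, scale := 2 ^ (j + 1) * R.Δmin,
        δ := levelRadius R.ε R.Δmin (j + 1),
        src := x, dst := y, cnt := u, mode := v, last := w, c := c } m' ?_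
        ⟨⟨x, y, u, v, w, c, rfl⟩, fun i hi => ?_, fun i h1 h2 => ?_⟩
      · simp [nextLevel, levelRadius, Nat.succ_mul, pow_succ', mul_assoc]
      · rcases Nat.lt_succ_iff_lt_or_eq.1 hi with hi | rfl
        · obtain ⟨c₁, l₁, e₁, h1, h2, h3, h4⟩ := hdone i hi
          exact ⟨c₁, l₁, e₁, h1, h2, h3.congr hsame hi.ne, by rw [(hsame.real i hi.ne).2, h4]⟩
        · exact ⟨c', l', e', hc, hins, hrep', hreal⟩
      · exact (htodo i (by omega) h2).congr hsame (by omega)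
    · rintro _ m ⟨⟨x, y, u, v, w, c, rfl⟩, -⟩
      simpa using hn'
    rintro _ m ⟨⟨x, y, u, v, w, c, rfl⟩, hdone, -⟩
    have hA6 : 6 < A := by omega
    have hM0 : 0 < M := by omega
    refine Runs.of_wp_eq { R with
      lvl := n, base := n * R.cap, scale := 2 ^ n * R.Δmin, δ := levelRadius R.ε R.Δmin n,
      src := x, dst := y, cnt := u, mode := v, last := w, c := c }
      { m with nat := setCell m.nat 6 0 n } ?_ ⟨ht, by simp, fun i hi => ?_⟩
    · simp [hA6, hM0]
    · obtain ⟨c₁, l₁, e₁, h1, h2, h3, h4⟩ := hdone i hi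
      exact ⟨c₁, l₁, e₁, h1, h2, h3.of_eq (by simp) (by simp) (by simp) rfl rfl rfl, h4⟩
  refine key.mono ?_ fun _ _ h => h
  have hs : 5 + 1 + (100 * (R.cap + 1) + nextLevel.steps) ≤ 200 * (R.cap + 1) := by
    simp only [nextLevel, Prog.steps, NExp.cost, RExp.cost]
    omega
  have := Nat.mul_le_mul_left n hs
  rw [Nat.mul_left_comm] at this
  omega

end Programs

/-! ## Processing the events in order -/

section Events

/-- A process that changes its state at the elements of a locally finite set of times only. -/
theorem exists_run {β : Type*} (E : Set ℝ) (hfin : ∀ t, {v | v ∈ E ∧ v ≤ t}.Finite) (b : β)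
    (Inv : ℝ → β → Prop) (R : ℝ → β → β → Prop) (h0 : ∀ t, (∀ v ∈ E, t < v) → Inv t b)
    (hidle : ∀ t t' m, t ≤ t' → (∀ v ∈ E, ¬ (t < v ∧ v ≤ t')) → Inv t m → Inv t' m)
    (hstep : ∀ t v m, t < v → v ∈ E → (∀ w ∈ E, ¬ (t < w ∧ w < v)) → Inv t m →
      ∃ m', R v m m' ∧ Inv v m') :
    ∃ mem : ℝ → β, (∀ t, (∀ v ∈ E, t < v) → mem t = b) ∧
      (∀ t t', t ≤ t' → (∀ v ∈ E, ¬ (t < v ∧ v ≤ t')) → mem t' = mem t) ∧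
      (∀ t v, t < v → v ∈ E → (∀ w ∈ E, ¬ (t < w ∧ w < v)) → R v (mem t) (mem v)) ∧
      ∀ t, Inv t (mem t) := by
  classical
  -- A successor is guaranteed only under the invariant, so the step is total with a default. The
  -- induction on the number of past events shows that the default is never used in `mem`.
  let step : β → ℝ → β := fun m v => if h : ∃ m', R v m m' ∧ Inv v m' then h.choose else m
  let F : ℝ → Finset ℝ := fun t => (hfin t).toFinset
  let mem : ℝ → β := fun t => ((F t).sort (· ≤ ·)).foldl step b
  have hF : ∀ t v, v ∈ F t ↔ v ∈ E ∧ v ≤ t := fun t v => by simp [F]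
  have hblank : ∀ t, (∀ v ∈ E, t < v) → mem t = b := by
    intro t ht
    have : F t = ∅ := by
      ext v
      rw [hF]
      simpa using fun hv => ht v hv
    simp [mem, this]
  have hmem_idle : ∀ t t', t ≤ t' → (∀ v ∈ E, ¬ (t < v ∧ v ≤ t')) → mem t' = mem t := by
    intro t t' htt' h
    have : F t' = F t := by
      ext v
      rw [hF, hF]
      refine and_congr_right fun hv => ⟨fun h' => ?_, fun h' => h'.trans htt'⟩
      by_contra hlt
      exact h v hv ⟨not_le.1 hlt, h'⟩
    simp [mem, this]
  have hmem_step : ∀ t v, t < v → v ∈ E → (∀ w ∈ E, ¬ (t < w ∧ w < v)) →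
      mem v = step (mem t) v := by
    intro t v htv hv h
    have hsort : (F v).sort (· ≤ ·) = (F t).sort (· ≤ ·) ++ [v] := by
      refine List.Perm.eq_of_pairwise (le := (· ≤ ·)) (fun a b _ _ => le_antisymm)
        (Finset.pairwise_sort _ _) ?_ ?_
      · refine List.pairwise_append.2 ⟨Finset.pairwise_sort _ _, List.pairwise_singleton _ _, ?_⟩
        intro x hx y hy
        rw [List.mem_singleton.1 hy]
        exact (((hF t x).1 ((Finset.mem_sort _).1 hx)).2.trans_lt htv).le
      · refine (List.perm_ext_iff_of_nodup (Finset.sort_nodup _ _) ?_).2 fun x => ?_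
        · refine List.nodup_append.2 ⟨Finset.sort_nodup _ _, List.nodup_singleton _, ?_⟩
          intro x hx y hy
          rw [List.mem_singleton.1 hy]
          exact (((hF t x).1 ((Finset.mem_sort _).1 hx)).2.trans_lt htv).ne
        · rw [List.mem_append, Finset.mem_sort, Finset.mem_sort, hF, hF, List.mem_singleton]
          constructor
          · rintro ⟨h1, h2⟩
            rcases h2.lt_or_eq with h2 | h2
            · exact .inl ⟨h1, le_of_not_gt fun h3 => h x h1 ⟨h3, h2⟩⟩
            · exact .inr h2
          · rintro (⟨h1, h2⟩ | rfl)
            · exact ⟨h1, h2.trans htv.le⟩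
            · exact ⟨hv, le_rfl⟩
    simp [mem, hsort]
  have hInv : ∀ N t, (F t).card = N → Inv t (mem t) := by
    intro N
    induction N with
    | zero =>
      intro t ht
      have hE : ∀ v ∈ E, t < v := fun v hv => not_le.1 fun hle => by
        have := (hF t v).2 ⟨hv, hle⟩
        rw [Finset.card_eq_zero.1 ht] at this
        simp at this
      rw [hblank t hE]
      exact h0 t hE
    | succ N ih =>
      intro t ht
      have hne : (F t).Nonempty := Finset.card_pos.1 (by omega)
      set v := (F t).max' hne with hv
      obtain ⟨hvE, hvt⟩ := (hF t v).1 ((F t).max'_mem hne)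
      have hmax : ∀ w ∈ E, ¬ (v < w ∧ w ≤ t) := fun w hw h =>
        absurd ((F t).le_max' w ((hF t w).2 ⟨hw, h.2⟩)) (not_le.2 h.1)
      -- Here `s` is the preceding event, or any earlier time if `v` is the first event.
      obtain ⟨s, hsv, hs⟩ : ∃ s < v, ∀ w ∈ E, ¬ (s < w ∧ w < v) := by
        by_cases hne' : ((F t).erase v).Nonempty
        · refine ⟨((F t).erase v).max' hne', ?_, fun w hw h => ?_⟩
          · have h1 := Finset.mem_erase.1 (((F t).erase v).max'_mem hne')
            exact lt_of_le_of_ne ((F t).le_max' _ h1.2) h1.1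
          · have := ((F t).erase v).le_max' w (Finset.mem_erase.2 ⟨h.2.ne,
              (hF t w).2 ⟨hw, h.2.le.trans hvt⟩⟩)
            exact absurd this (not_le.2 h.1)
        · refine ⟨v - 1, by linarith, fun w hw h => hne' ⟨w, Finset.mem_erase.2 ⟨h.2.ne,
            (hF t w).2 ⟨hw, h.2.le.trans hvt⟩⟩⟩⟩
      have hcard : (F s).card = N := by
        have : F s = (F t).erase v := by
          ext w
          rw [Finset.mem_erase, hF, hF]
          constructor
          · rintro ⟨h1, h2⟩
            exact ⟨(h2.trans_lt hsv).ne, h1, (h2.trans hsv.le).trans hvt⟩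
          · rintro ⟨h1, h2, h3⟩
            refine ⟨h2, le_of_not_gt fun h4 => ?_⟩
            rcases lt_or_gt_of_ne h1 with h5 | h5
            · exact hs w h2 ⟨h4, h5⟩
            · exact hmax w h2 ⟨h5, h3⟩
        rw [this, Finset.card_erase_of_mem ((F t).max'_mem hne), ht]
        rfl
      have hex := hstep s v (mem s) hsv hvE hs (ih s hcard)
      have hstep_v : Inv v (mem v) := by
        rw [hmem_step s v hsv hvE hs]
        simp only [step, dif_pos hex]
        exact hex.choose_spec.2
      rw [hmem_idle v t hvt hmax]
      exact hidle v t _ hvt hmax hstep_v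
  refine ⟨mem, hblank, hmem_idle, fun t v htv hv h => ?_, fun t => hInv _ t rfl⟩
  have hex := hstep t v (mem t) htv hv h (hInv _ t rfl)
  rw [hmem_step t v htv hv h]
  simp only [step, dif_pos hex]
  exact hex.choose_spec.1

variable {X : Type u}

theorem finite_events (S : PointStream X) (W t : ℝ) : {v | v ∈ S.events W ∧ v ≤ t}.Finite := by
  refine (((S.finite_arr t).image S.arr).union
    ((S.finite_arr (t - W)).image fun i => S.arr i + W)).subset ?_
  rintro v ⟨⟨i, rfl | rfl⟩, hv⟩
  · exact .inl ⟨i, hv, rfl⟩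
  · exact .inr ⟨i, show S.arr i ≤ t - W by linarith, rfl⟩

variable {S : PointStream X} {W t v : ℝ}

theorem windowIdx_idle (htv : t ≤ v) (h : ∀ w ∈ S.events W, ¬ (t < w ∧ w ≤ v)) :
    windowIdx S W v = windowIdx S W t := by
  ext i
  rw [mem_windowIdx, mem_windowIdx]
  constructor
  · rintro ⟨h1, h2⟩
    exact ⟨le_of_not_gt fun h3 => h _ ⟨i, .inl rfl⟩ ⟨h3, h1⟩, htv.trans_lt h2⟩
  · rintro ⟨h1, h2⟩
    exact ⟨h1.trans htv, lt_of_not_ge fun h3 => h _ ⟨i, .inr rfl⟩ ⟨h2, h3⟩⟩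

theorem active_arrive (hW : 0 < W) (hS : S.DistinctTimes W) {a : S.ι} (hta : t < S.arr a)
    (h : ∀ w ∈ S.events W, ¬ (t < w ∧ w < S.arr a)) (j : S.ι) :
    S.arr j ≤ S.arr a ∧ S.arr a < S.arr j + W ↔ (S.arr j ≤ t ∧ t < S.arr j + W) ∨ j = a := by
  constructor
  · rintro ⟨h1, h2⟩
    by_cases hj : S.arr j ≤ t
    · exact .inl ⟨hj, hta.trans h2⟩
    · refine .inr (hS.1 (le_antisymm h1 (le_of_not_gt fun h3 => ?_)))
      exact h _ ⟨j, .inl rfl⟩ ⟨not_le.1 hj, h3⟩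
  · rintro (⟨h1, h2⟩ | rfl)
    · refine ⟨h1.trans hta.le, lt_of_le_of_ne (le_of_not_gt fun h3 => ?_) (hS.2 a j)⟩
      exact h _ ⟨j, .inr rfl⟩ ⟨h2, h3⟩
    · exact ⟨le_rfl, by linarith⟩

theorem active_depart (hW : 0 < W) (hS : S.DistinctTimes W) {q : S.ι} (htq : t < S.arr q + W)
    (h : ∀ w ∈ S.events W, ¬ (t < w ∧ w < S.arr q + W)) (i : S.ι) :
    S.arr i ≤ t ∧ t < S.arr i + W ↔
      (S.arr i ≤ S.arr q + W ∧ S.arr q + W < S.arr i + W) ∨ i = q := by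
  constructor
  · rintro ⟨h1, h2⟩
    by_cases hi : S.arr q + W < S.arr i + W
    · exact .inl ⟨h1.trans htq.le, hi⟩
    · refine .inr (hS.1 (le_antisymm (by linarith) (le_of_not_gt fun h3 => ?_)))
      exact h _ ⟨i, .inr rfl⟩ ⟨h2, by linarith⟩
  · rintro (⟨h1, h2⟩ | rfl)
    · refine ⟨le_of_not_gt fun h3 => ?_, htq.trans h2⟩
      exact h _ ⟨i, .inl rfl⟩ ⟨h3, lt_of_le_of_ne h1 (hS.2 i q)⟩
    · exact ⟨le_of_not_gt fun h3 => h _ ⟨i, .inl rfl⟩ ⟨h3, by linarith⟩, htq⟩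

end Events

/-! ## The parameters of the sketch -/

section Parameters

/-- Taking the least `J` that reaches `10` keeps `2 ^ J * ε` below `20`. For `B < 2` no
multiplications are made: when `B = 1` they would not change the power, and for `d < 1` their number
need not be `O(1 / ε ^ d)`. -/
theorem exists_powCount (B : ℕ) {ε : ℝ} (h0 : 0 < ε) (h1 : ε < 1) :
    ∃ J : ℕ, (∀ j < J, 2 ≤ B ∧ (2 : ℝ) ^ j * ε < 10) ∧ (2 ≤ B → 10 ≤ (2 : ℝ) ^ J * ε) ∧
      (2 : ℝ) ^ J * ε ≤ 20 := by
  classical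
  by_cases hB : 2 ≤ B
  · have hex : ∃ j : ℕ, 10 ≤ (2 : ℝ) ^ j * ε := by
      obtain ⟨j, hj⟩ := pow_unbounded_of_one_lt (10 / ε) (one_lt_two : (1 : ℝ) < 2)
      exact ⟨j, ((div_lt_iff₀ h0).1 hj).le⟩
    refine ⟨Nat.find hex, fun j hj => ⟨hB, not_le.1 (Nat.find_min hex hj)⟩,
      fun _ => Nat.find_spec hex, ?_⟩
    rcases h : Nat.find hex with _ | j
    · norm_num; linarith
    · have := Nat.find_min hex (show j < Nat.find hex by omega)
      rw [pow_succ]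
      linarith
  · exact ⟨0, by simp, fun h => absurd h hB, by norm_num; linarith⟩

/-- The least failing `n` works: its predecessor satisfies `2 ^ (n - 1) ≤ 4 * σ`, so `n ≤ 3 + log
σ`. -/
theorem exists_levelCount {Δmin Δmax : ℝ} (h0 : 0 < Δmin) (h1 : Δmin ≤ Δmax) :
    ∃ n : ℕ, 0 < n ∧ (∀ i < n, 2 ^ i * Δmin ≤ 4 * Δmax) ∧ ¬ 2 ^ n * Δmin ≤ 4 * Δmax ∧
      (n : ℝ) ≤ 3 * (1 + Real.logb 2 (Δmax / Δmin)) := by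
  classical
  have hex : ∃ i : ℕ, ¬ 2 ^ i * Δmin ≤ 4 * Δmax := by
    obtain ⟨i, hi⟩ := pow_unbounded_of_one_lt (4 * Δmax / Δmin) (one_lt_two : (1 : ℝ) < 2)
    exact ⟨i, not_le.2 ((div_lt_iff₀ h0).1 hi)⟩
  have hmin : ∀ i < Nat.find hex, 2 ^ i * Δmin ≤ 4 * Δmax := fun i hi =>
    not_not.1 (Nat.find_min hex hi)
  have hpos : 0 < Nat.find hex := by
    rw [Nat.find_pos]
    simp only [pow_zero, one_mul, not_not]
    linarith
  refine ⟨_, hpos, hmin, Nat.find_spec hex, ?_⟩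
  obtain ⟨j, hj⟩ : ∃ j, Nat.find hex = j + 1 := ⟨Nat.find hex - 1, by omega⟩
  have h2 := hmin j (by omega)
  have hσ : 1 ≤ Δmax / Δmin := (one_le_div h0).2 h1
  have hlog : 0 ≤ Real.logb 2 (Δmax / Δmin) := Real.logb_nonneg one_lt_two hσ
  have h3 : (2 : ℝ) ^ (j : ℝ) ≤ 4 * (Δmax / Δmin) := by
    rw [Real.rpow_natCast, ← mul_div_assoc]
    exact (le_div_iff₀ h0).2 h2
  have h4 := (Real.le_logb_iff_rpow_le one_lt_two (by positivity)).2 h3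
  rw [Real.logb_mul (by norm_num) (by positivity)] at h4
  have h5 : Real.logb 2 4 = 2 := by
    rw [show (4 : ℝ) = 2 ^ (2 : ℝ) by norm_num, Real.logb_rpow (by norm_num) (by norm_num)]
  rw [hj]
  push_cast
  linarith

theorem one_le_floor_rpow {d : ℝ} (hd : 0 ≤ d) : 1 ≤ ⌊(2 : ℝ) ^ d⌋₊ :=
  Nat.le_floor (by simpa using Real.one_le_rpow one_le_two hd)

theorem floor_pow_le {d : ℝ} (hd : 0 ≤ d) {ε : ℝ} (h0 : 0 < ε) {J : ℕ}
    (hJ : (2 : ℝ) ^ J * ε ≤ 20) : ((⌊(2 : ℝ) ^ d⌋₊ : ℝ)) ^ J ≤ 20 ^ d / ε ^ d := by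
  calc ((⌊(2 : ℝ) ^ d⌋₊ : ℝ)) ^ J ≤ ((2 : ℝ) ^ d) ^ J :=
        pow_le_pow_left₀ (by positivity) (Nat.floor_le (by positivity)) J
    _ = ((2 : ℝ) ^ J) ^ d := by
        rw [← Real.rpow_natCast, ← Real.rpow_natCast, ← Real.rpow_mul (by norm_num),
          ← Real.rpow_mul (by norm_num), mul_comm]
    _ ≤ (20 / ε) ^ d := Real.rpow_le_rpow (by positivity) ((le_div_iff₀ h0).2 hJ) hd
    _ = 20 ^ d / ε ^ d := Real.div_rpow (by norm_num) h0.le d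

/-- A positive `J` forces `d ≥ 1`, and then `J ≤ 2 ^ J ≤ 20 / ε ≤ 20 / ε ^ d`. -/
theorem powCount_le {d : ℝ} {ε : ℝ} (h0 : 0 < ε) (h1 : ε < 1) {J : ℕ}
    (hB : ∀ j < J, 2 ≤ ⌊(2 : ℝ) ^ d⌋₊) (hJ : (2 : ℝ) ^ J * ε ≤ 20) : (J : ℝ) ≤ 20 / ε ^ d := by
  have hε : 0 < ε ^ d := Real.rpow_pos_of_pos h0 d
  rcases Nat.eq_zero_or_pos J with rfl | hpos
  · simp; positivity
  have h2 : (2 : ℝ) ^ (1 : ℝ) ≤ 2 ^ d := by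
    have h3 := Nat.floor_le (show (0 : ℝ) ≤ 2 ^ d by positivity)
    have h4 : (2 : ℝ) ≤ (⌊(2 : ℝ) ^ d⌋₊ : ℝ) := by exact_mod_cast hB 0 hpos
    rw [Real.rpow_one]
    linarith
  have hd : 1 ≤ d := (Real.rpow_le_rpow_left_iff one_lt_two).1 h2
  have h5 : ε ^ d ≤ ε := by
    simpa using Real.rpow_le_rpow_of_exponent_ge h0 h1.le hd
  have h6 : (J : ℝ) ≤ 2 ^ J := by exact_mod_cast Nat.lt_two_pow_self.le
  rw [le_div_iff₀ hε]
  nlinarith [pow_pos (zero_lt_two' ℝ) J]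

theorem packs_level {X : Type u} [MetricSpace X] {d : ℝ} (hd : 0 ≤ d) (hX : DoublingDimLE X d)
    {S : PointStream X} {ε Δmin Δmax : ℝ} (h0 : 0 < ε) (h1 : ε < 1) (hΔ : 0 < Δmin)
    (hS : S.DistBounds Δmin Δmax) {J : ℕ} (hJ : 2 ≤ ⌊(2 : ℝ) ^ d⌋₊ → 10 ≤ (2 : ℝ) ^ J * ε)
    (i : ℕ) :
    Packs (Set.range S.pt) (levelRadius ε Δmin i) (2 ^ i * Δmin / 2) (⌊(2 : ℝ) ^ d⌋₊ ^ J) := by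
  have hB := one_le_floor_rpow hd
  rcases Nat.eq_zero_or_pos i with rfl | hi
  · rw [levelRadius, if_pos rfl, pow_zero, one_mul]
    refine packs_zero ?_ (Nat.one_le_pow _ _ hB)
    rintro _ ⟨i, rfl⟩ _ ⟨j, rfl⟩ hne
    exact (hS i j hne).1
  -- If the doubling constant is `1`, the exponent is irrelevant to the power and may be taken as
  -- large as the packing bound requires.
  · obtain ⟨j, hj, hjB⟩ : ∃ j : ℕ, 10 ≤ (2 : ℝ) ^ j * ε ∧
        ⌊(2 : ℝ) ^ d⌋₊ ^ j = ⌊(2 : ℝ) ^ d⌋₊ ^ J := by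
      by_cases hB2 : 2 ≤ ⌊(2 : ℝ) ^ d⌋₊
      · exact ⟨J, hJ hB2, rfl⟩
      · obtain ⟨j, hj⟩ := pow_unbounded_of_one_lt (10 / ε) (one_lt_two : (1 : ℝ) < 2)
        refine ⟨j, ((div_lt_iff₀ h0).1 hj).le, ?_⟩
        rw [show ⌊(2 : ℝ) ^ d⌋₊ = 1 by omega, one_pow, one_pow]
    rw [← hjB, levelRadius, if_neg hi.ne']
    have hs : 0 < 2 ^ i * Δmin := by positivity
    refine packs_of_doubling hX _ (by positivity) (by positivity) ?_
    -- With `s = 2 ^ i * Δmin`, the left side is `s + ε * s / 4 ≤ 5 * s / 4`, and the right side is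
    -- at least `10 * s / 8`; this is where `10` comes from.
    nlinarith [mul_le_mul_of_nonneg_left hj hs.le, mul_le_mul_of_nonneg_left h1.le hs.le]

end Parameters

/-! ## The sketch -/

section Sketch

variable {X : Type u}

/-- The registers when a program is started. -/
noncomputable def startRegs (π : Params) (t : ℝ) (p : Option X) : Regs X where
  k := π.k
  z := π.z
  num := 0
  cap := 0
  lvl := 0
  base := 0
  src := 0
  dst := 0
  cnt := 0
  mode := 0
  last := 0
  time := t
  W := π.W
  ε := π.ε
  Δmin := π.Δmin
  Δmax := π.Δmax
  scale := 0
  δ := 0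
  pow := 0
  p := p
  c := none

theorem startState_eq (π : Params) (m : Memory X) (t : ℝ) (p : Option X) :
    startState π m t p = (startRegs π t p).state m := by
  unfold startState Regs.state
  congr 1
  · funext x
    rcases x with _|_|_|_|_|_|_|_|_|_|_|x <;> simp [startRegs, Regs.nat]
  · funext x
    rcases x with _|_|_|_|_|_|_|_|x <;> simp [startRegs, Regs.real]
  · funext x
    rcases x with _|_|x <;> simp [startRegs, Regs.pt]

variable [MetricSpace X]

/-- The list of points and the additional radius selected in the memory allow to report a good
solution for the window. -/
def ReportOK (S : PointStream X) (π : Params) (cap : ℕ) (t : ℝ) (m : Memory X) : Prop :=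
  ∃ Q : List X, cellRange (m.pt 0) (m.nat 4 0) 1 (m.nat 5 0) = Q ∧ Q.length ≤ cap ∧
    (Q : Multiset X) ≤ S.window π.W t ∧
    m.real 3 0 ≤ π.ε * opt π.k π.z (S.window π.W t) ∧
    ∀ C r, IsSolution π.k π.z (Q : Multiset X) C r →
      IsSolution π.k π.z (S.window π.W t) C (r + m.real 3 0)

/-- The invariant of the sketch with `n` levels. -/
def SketchInv (S : PointStream X) (π : Params) (cap n : ℕ) (t : ℝ) (m : Memory X) : Prop :=
  (∃ (l : ℕ → List (S.ι × X)) (e : ℕ → Option ℝ),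
    (∀ i < n, LevelRep S π.W cap m i (l i) (e i)) ∧
    ∀ i < n, LevelInv S π.W (levelRadius π.ε π.Δmin i) (2 ^ i * π.Δmin / 2) π.k π.z cap t
      (l i) (e i)) ∧
  ((∀ i, t < S.arr i) ∧ m = Memory.blank ∨ m.nat 6 0 = n ∧ ∀ i < n, m.real 2 i =
    levelRadius π.ε π.Δmin i + levelRadius π.ε π.Δmin i) ∧
  ReportOK S π cap t m

theorem levelRadius_nonneg {ε Δ : ℝ} (hε : 0 < ε) (hΔ : 0 < Δ) (i : ℕ) :
    0 ≤ levelRadius ε Δ i := by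
  unfold levelRadius
  split_ifs <;> positivity

variable {S : PointStream X} {π : Params} {cap n : ℕ} {t : ℝ}

/-- The selected level is valid and hence a coreset; its predecessor, if any, is invalid and bounds
the optimum from below, which pays for the additional radius. -/
theorem reportOK_of_selected {m : Memory X} {l : ℕ → List (S.ι × X)} {e : ℕ → Option ℝ}
    (hk : 1 ≤ π.k) (hε : 0 < π.ε) (hΔ : 0 < π.Δmin)
    (hinv : ∀ i < n, LevelInv S π.W (levelRadius π.ε π.Δmin i) (2 ^ i * π.Δmin / 2) π.k π.z cap t
      (l i) (e i)) {i : ℕ} (hi : i < n) (hv : Valid t (e i)) (hf : ∀ i' < i, ¬ Valid t (e i'))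
    (hs : Selected S m (l i) (levelRadius π.ε π.Δmin i + levelRadius π.ε π.Δmin i)) :
    ReportOK S π cap t m := by
  have hl := hinv i hi
  have hδ := levelRadius_nonneg hε hΔ i
  obtain ⟨h1, h2⟩ := hl.coreset hδ hv
  refine ⟨_, hs.1, by simpa using hl.len, h1, ?_, fun C r h => ?_⟩
  · rw [hs.2]
    rcases i with _ | i
    · simp only [levelRadius, if_true, add_zero]
      exact mul_nonneg hε.le (opt_nonneg _)
    · obtain ⟨e₀, he, hlt⟩ : ∃ e₀, e i = some e₀ ∧ ¬ e₀ ≤ t := by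
        simpa [Valid] using hf i (Nat.lt_succ_self i)
      have h3 := hinv i (by omega)
      rw [he] at h3
      have h4 := mul_le_mul_of_nonneg_left (h3.le_opt hk (not_le.1 hlt)) hε.le
      rw [levelRadius, if_neg (Nat.succ_ne_zero i), pow_succ]
      linarith
  · rw [hs.2, ← two_mul]
    exact h2 C r h

/-- If the last level were invalid, the optimum would be at least `2 ^ n * Δmin / 4`, which exceeds
`Δmax`. -/
theorem exists_valid {l : ℕ → List (S.ι × X)} {e : ℕ → Option ℝ}
    (hk : 1 ≤ π.k) (hΔ : 0 < π.Δmin) (hΔ' : π.Δmin ≤ π.Δmax) (hS : S.DistBounds π.Δmin π.Δmax)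
    (hn : ¬ 2 ^ n * π.Δmin ≤ 4 * π.Δmax) (hn0 : 0 < n)
    (hinv : ∀ i < n, LevelInv S π.W (levelRadius π.ε π.Δmin i) (2 ^ i * π.Δmin / 2) π.k π.z cap t
      (l i) (e i)) : ¬ ∀ i < n, ¬ Valid t (e i) := by
  intro h
  obtain ⟨j, rfl⟩ : ∃ j, n = j + 1 := ⟨n - 1, by omega⟩
  obtain ⟨e₀, he, hlt⟩ : ∃ e₀, e j = some e₀ ∧ ¬ e₀ ≤ t := by
    simpa [Valid] using h j (Nat.lt_succ_self j)
  have h3 := hinv j (by omega)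
  rw [he] at h3
  have h4 := h3.le_opt hk (not_le.1 hlt)
  have h5 : opt π.k π.z (S.window π.W t) ≤ π.Δmax := by
    refine opt_le_of_dist_le hk (by linarith) fun p hp q hq => ?_
    rw [window_eq] at hp hq
    obtain ⟨a, -, rfl⟩ := Multiset.mem_map.1 hp
    obtain ⟨b, -, rfl⟩ := Multiset.mem_map.1 hq
    by_cases hab : S.pt a = S.pt b
    · rw [hab, dist_self]
      linarith
    · exact (hS a b hab).2
  apply hn
  rw [pow_succ]
  linarith

/-- The zeros of blank memory already describe an empty selection at level `0` with additional
radius `0`. -/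
theorem sketchInv_blank (hk : 1 ≤ π.k) (hε : 0 < π.ε) (hΔ : 0 < π.Δmin) (hn0 : 0 < n)
    (ht : ∀ i, t < S.arr i) : SketchInv S π cap n t Memory.blank := by
  have hinv : ∀ i < n, LevelInv S π.W (levelRadius π.ε π.Δmin i) (2 ^ i * π.Δmin / 2) π.k π.z cap t
      ((fun _ => [] : ℕ → List (S.ι × X)) i) ((fun _ => none : ℕ → Option ℝ) i) :=
    fun i _ => LevelInv.empty ht
  refine ⟨⟨_, _, fun i _ => ?_, hinv⟩, .inl ⟨ht, rfl⟩, ?_⟩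
  · exact ⟨rfl, by simp, fun j hj => by simp at hj, fun _ => rfl, by simp⟩
  · refine reportOK_of_selected hk hε hΔ hinv hn0 (by simp [Valid]) (by simp) ⟨?_, ?_⟩
    · simp [cellRange, Memory.blank]
    · simp [levelRadius, Memory.blank]

theorem SketchInv.idle {m : Memory X} {t' : ℝ} (h : SketchInv S π cap n t m) (ht : t ≤ t')
    (hev : ∀ v ∈ S.events π.W, ¬ (t < v ∧ v ≤ t')) : SketchInv S π cap n t' m := by
  have hw := windowIdx_idle ht hev
  obtain ⟨⟨l, e, hrep, hinv⟩, hm, hr⟩ := h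
  refine ⟨⟨l, e, hrep, fun i hi => (hinv i hi).idle ht hw⟩, ?_, ?_⟩
  · refine hm.imp_left fun h => ⟨fun i => ?_, h.2⟩
    exact not_le.1 fun hle => hev _ ⟨i, .inl rfl⟩ ⟨h.1 i, hle⟩
  · unfold ReportOK at hr ⊢
    rwa [window_eq, hw, ← window_eq]

variable {alg : StaticAlg X} {A M B J : ℕ}

theorem SketchInv.of_depart {m : Memory X} {q : S.ι} (hA : 6 ≤ A) (hn0 : 0 < n) (hnM : n ≤ M)
    (hk : 1 ≤ π.k) (hε : 0 < π.ε) (hW : 0 < π.W) (hΔ : 0 < π.Δmin) (hΔ' : π.Δmin ≤ π.Δmax)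
    (hn : ¬ 2 ^ n * π.Δmin ≤ 4 * π.Δmax)
    (hS : S.DistinctTimes π.W) (hSd : S.DistBounds π.Δmin π.Δmax)
    (h : SketchInv S π cap n t m) (htq : t < S.arr q + π.W)
    (hev : ∀ v ∈ S.events π.W, ¬ (t < v ∧ v < S.arr q + π.W)) :
    ∃ n' ≤ 100 * (n + 1), ∃ s, Exec alg A M refresh (startState π m (S.arr q + π.W) none) n' s ∧
      SketchInv S π cap n (S.arr q + π.W) s.mem := by
  obtain ⟨⟨l, e, hrep, hinv⟩, hm, -⟩ := h
  have hact := active_depart hW hS htq hev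
  have hq := ((hact q).2 (.inr rfl)).1
  -- The number of levels and the radii are written at an arrival, and the departing point has
  -- arrived before.
  obtain ⟨hm6, hm2⟩ : m.nat 6 0 = n ∧ ∀ i < n, m.real 2 i =
      levelRadius π.ε π.Δmin i + levelRadius π.ε π.Δmin i :=
    hm.resolve_left fun h => absurd (h.1 q) (not_lt.2 hq)
  rw [startState_eq]
  obtain ⟨n', hn', R', m', hex, hrep', h6, h2, hsel⟩ := runs_refresh (alg := alg) (A := A) (M := M)
    (R := startRegs π (S.arr q + π.W) none) hA hnM hm6 hrep
  have hinv' := fun i hi => (hinv i hi).expire htq.le rfl hact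
  refine ⟨n', hn', _, hex, ⟨_, _, hrep', hinv'⟩, .inr ⟨by rw [← hm6]; exact congrFun h6 0,
    fun i hi => (congrFun h2 i).trans (hm2 i hi)⟩, ?_⟩
  rcases hsel with hno | ⟨i, hi, hv, hf, hs⟩
  · exact absurd hno (exists_valid hk hΔ hΔ' hSd hn hn0 hinv')
  · rw [hm2 i hi] at hs
    exact reportOK_of_selected hk hε hΔ hinv' hi hv hf hs

theorem SketchInv.of_arrive {m : Memory X} {a : S.ι} (hA : 7 ≤ A) (hn0 : 0 < n)
    (hM : n * cap ≤ M)
    (hk : 1 ≤ π.k) (hε : 0 < π.ε) (hW : 0 < π.W) (hΔ : 0 < π.Δmin) (hΔ' : π.Δmin ≤ π.Δmax)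
    (hn : ∀ i < n, 2 ^ i * π.Δmin ≤ 4 * π.Δmax) (hn' : ¬ 2 ^ n * π.Δmin ≤ 4 * π.Δmax)
    (hJ : ∀ j < J, 2 ≤ B ∧ (2 : ℝ) ^ j * π.ε < 10) (hJ' : 2 ≤ B → 10 ≤ (2 : ℝ) ^ J * π.ε)
    (hB : 1 ≤ B) (hcap : cap = π.k * B ^ J * (π.z + 1) + π.z)
    (hpack : ∀ i, Packs (Set.range S.pt) (levelRadius π.ε π.Δmin i) (2 ^ i * π.Δmin / 2) (B ^ J))
    (hS : S.DistinctTimes π.W) (hSd : S.DistBounds π.Δmin π.Δmax)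
    (h : SketchInv S π cap n t m) (hta : t < S.arr a)
    (hev : ∀ v ∈ S.events π.W, ¬ (t < v ∧ v < S.arr a)) :
    ∃ n' ≤ 100 * (J * (B + 1) + π.z + 1) + (200 * (n * (cap + 1) + 1) + 100 * (n + 1)), ∃ s,
      Exec alg A M (arrive B) (startState π m (S.arr a) (some (S.pt a))) n' s ∧
      SketchInv S π cap n (S.arr a) s.mem := by
  obtain ⟨⟨l, e, hrep, hinv⟩, -, -⟩ := h
  have hact := active_arrive hW hS hta hev
  have hBJ : 1 ≤ B ^ J := Nat.one_le_pow _ _ hB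
  have hcap1 : 1 ≤ cap := by
    have : 0 < π.k * B ^ J * (π.z + 1) := by positivity
    omega
  have hnM : n ≤ M := by nlinarith
  have key : Runs alg A M (arrive B) (startRegs π (S.arr a) (some (S.pt a))) m
      (100 * (J * (B + 1) + π.z + 1) + (200 * (n * (cap + 1) + 1) + 100 * (n + 1)))
      fun _ m' => SketchInv S π cap n (S.arr a) m' := by
    refine Runs.seq (runs_computeCap (R := startRegs π (S.arr a) (some (S.pt a))) hJ hJ') ?_
    rintro _ m ⟨rfl, x, y, p, rfl⟩
    have hcap' : (startRegs π (S.arr a) (some (S.pt a))).k * B ^ J *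
        ((startRegs π (S.arr a) (some (S.pt a))).z + 1) +
        (startRegs π (S.arr a) (some (S.pt a))).z = cap := hcap.symm
    rw [hcap']
    refine Runs.seq (runs_arriveLevels (S := S) (W := π.W) (l := l) (e := e) a hA hcap1 hM hn hn'
      hn0 rfl rfl rfl hrep fun i hi => (hinv i hi).len) ?_
    rintro R' m' ⟨htime, hm6, hlev⟩
    dsimp only [startRegs] at hlev
    have hex : ∀ i, ∃ l' e', i < n → LevelRep S π.W cap m' i l' e' ∧
        m'.real 2 i = levelRadius π.ε π.Δmin i + levelRadius π.ε π.Δmin i ∧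
        LevelInv S π.W (levelRadius π.ε π.Δmin i) (2 ^ i * π.Δmin / 2) π.k π.z cap (S.arr a)
          l' e' := by
      intro i
      by_cases hi : i < n
      · obtain ⟨c, l', e', hc, hins, hrep', hr⟩ := hlev i hi
        exact ⟨l', e', fun _ => ⟨hrep', hr, (hinv i hi).insert (levelRadius_nonneg hε hΔ i) hW hk
          hBJ hcap (hpack i) hta hact hc hins⟩⟩
      · exact ⟨[], none, fun h => absurd h hi⟩
    choose l' e' hle using hex
    refine (runs_refresh (by omega) hnM hm6 fun i hi => (hle i hi).1).mono le_rfl ?_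
    rintro R'' m'' ⟨hrep'', h6, h2, hsel⟩
    rw [htime] at hrep'' hsel
    -- The selection pass also looks for expired entries, but at an arrival there are none.
    have hexp : ∀ i < n, expire S π.W (S.arr a) (l' i) = l' i := fun i hi =>
      expire_eq_self fun y hy => ((hle i hi).2.2.active y hy).2
    have hinv' := fun i hi => (hle i hi).2.2
    refine ⟨⟨l', e', fun i hi => ?_, hinv'⟩, .inr ⟨by rw [← hm6]; exact congrFun h6 0,
      fun i hi => (congrFun h2 i).trans (hle i hi).2.1⟩, ?_⟩
    · rw [← hexp i hi]
      exact hrep'' i hi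
    · rcases hsel with hno | ⟨i, hi, hv, hf, hs⟩
      · exact absurd hno (exists_valid hk hΔ hΔ' hSd hn' hn0 hinv')
      · rw [(hle i hi).2.1, hexp i hi] at hs
        exact reportOK_of_selected hk hε hΔ hinv' hi hv hf hs
  rw [startState_eq]
  obtain ⟨n', hle, R', m', hex, h⟩ := key
  exact ⟨n', hle, _, hex, h⟩

theorem exec_report (m : Memory X) (R : State X) (hm : R.mem = m) {Q : List X}
    (hQ : cellRange (m.pt 0) (m.nat 4 0) 1 (m.nat 5 0) = Q) :
    ∃ s, Exec alg A M report R (alg.time Q + 11) s ∧ s.mem = m ∧ s.out = alg.centers Q ∧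
      s.rreg 0 = alg.radius Q + m.real 3 0 := by
  subst hm
  have h1 := Exec.call (alg := alg) (A := A) (M := M) R 0 (.load 4 (.lit 0)) (.lit 1)
    (.load 5 (.lit 0)) 0 Q hQ.symm
  have h2 := h1.seq (Exec.setR _ 0 (.add (.reg 0) (.load 3 (.lit 0))))
  have hcast : ∀ {n n' s}, Exec alg A M report R n s → n = n' → Exec alg A M report R n' s :=
    fun h hn => hn ▸ h
  refine ⟨_, hcast h2 ?_, rfl, rfl, ?_⟩
  · simp only [NExp.cost, RExp.cost]
    omega
  · simp [RExp.val, NExp.val]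

/-- The sketch can be maintained on any stream. -/
theorem exists_sketch {d : ℝ} (hd : 0 ≤ d) (hX : DoublingDimLE X d) (hk : 1 ≤ π.k)
    (hε : 0 < π.ε) (hε1 : π.ε < 1) (hW : 0 < π.W) (hΔ : 0 < π.Δmin) (hΔ' : π.Δmin ≤ π.Δmax)
    (hn0 : 0 < n) (hn : ∀ i < n, 2 ^ i * π.Δmin ≤ 4 * π.Δmax)
    (hn' : ¬ 2 ^ n * π.Δmin ≤ 4 * π.Δmax) (hB : B = ⌊(2 : ℝ) ^ d⌋₊)
    (hJ : ∀ j < J, 2 ≤ B ∧ (2 : ℝ) ^ j * π.ε < 10) (hJ' : 2 ≤ B → 10 ≤ (2 : ℝ) ^ J * π.ε)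
    (hcap : cap = π.k * B ^ J * (π.z + 1) + π.z)
    (hS : S.DistinctTimes π.W) (hSd : S.DistBounds π.Δmin π.Δmax) {c : ℝ} (hc : 1 ≤ c)
    (halg : alg.IsApprox π.k π.z c) {T : ℕ → ℝ} (hT : alg.RunsIn T) {tArr tDep : ℝ}
    (htArr : ((100 * (J * (B + 1) + π.z + 1) + (200 * (n * (cap + 1) + 1) + 100 * (n + 1)) : ℕ) : ℝ)
      ≤ tArr) (htDep : ((100 * (n + 1) : ℕ) : ℝ) ≤ tDep) :
    ∃ mem : ℝ → Memory X, IsRun alg 7 (n * cap) (sketchAlg B) π S tArr tDep mem ∧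
      ∀ t : ℝ, ∃ (C : List X) (r : ℝ) (n' m : ℕ),
        Reports alg 7 (n * cap) (sketchAlg B) π (mem t) t C r n' ∧
        IsSolution π.k π.z (S.window π.W t) C r ∧
        r ≤ (1 + π.ε) * c * opt π.k π.z (S.window π.W t) ∧ m ≤ cap ∧ (n' : ℝ) ≤ T m + 11 := by
  have hB1 : 1 ≤ B := hB ▸ one_le_floor_rpow hd
  have hnM : n ≤ n * cap := by
    have : 0 < π.k * B ^ J * (π.z + 1) := by positivity
    exact Nat.le_mul_of_pos_right n (by omega)
  have hpack := packs_level hd hX hε hε1 hΔ hSd (hB ▸ hJ')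
  rw [← hB] at hpack
  obtain ⟨mem, hblank, hidle, hstep, hinv⟩ := exists_run (S.events π.W) (finite_events S π.W)
    (Memory.blank : Memory X) (SketchInv S π cap n)
    (fun v m m' =>
      (∀ i, v = S.arr i → ∃ (n' : ℕ) (s : State X),
        Exec alg 7 (n * cap) (arrive B) (startState π m v (some (S.pt i))) n' s ∧
        s.mem = m' ∧ (n' : ℝ) ≤ tArr) ∧
      (∀ i, v = S.arr i + π.W → ∃ (n' : ℕ) (s : State X),
        Exec alg 7 (n * cap) refresh (startState π m v none) n' s ∧
        s.mem = m' ∧ (n' : ℝ) ≤ tDep))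
    (fun t ht => sketchInv_blank hk hε hΔ hn0 fun i => ht _ ⟨i, .inl rfl⟩)
    (fun t t' m ht hev h => h.idle ht hev) (by
      rintro t v m htv ⟨a, rfl | rfl⟩ hev h
      · obtain ⟨n', hle, s, hex, hs⟩ := h.of_arrive (alg := alg) (A := 7) (M := n * cap) le_rfl hn0
          le_rfl hk hε hW hΔ hΔ' hn hn' hJ hJ' hB1 hcap hpack hS hSd htv hev
        -- Distinct times ensure that an event is the arrival or the departure of exactly one point.
        refine ⟨s.mem, ⟨fun i hi => ?_, fun i hi => absurd hi (hS.2 a i)⟩, hs⟩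
        obtain rfl := hS.1 hi
        exact ⟨n', s, hex, rfl, (Nat.cast_le.2 hle).trans htArr⟩
      · obtain ⟨n', hle, s, hex, hs⟩ := h.of_depart (alg := alg) (A := 7) (M := n * cap) (by norm_num)
          hn0 hnM hk hε hW hΔ hΔ' hn' hS hSd htv hev
        exact ⟨s.mem, ⟨fun i hi => absurd hi.symm (hS.2 i a), fun i _ =>
          ⟨n', s, hex, rfl, (Nat.cast_le.2 hle).trans htDep⟩⟩, hs⟩)
  refine ⟨mem, ⟨fun t ht => hblank t ?_, hidle, fun i t ht hev => ?_, fun i t ht hev => ?_⟩,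
    fun t => ?_⟩
  · rintro v ⟨i, rfl | rfl⟩
    · exact ht i
    · linarith [ht i]
  · exact (hstep t _ ht ⟨i, .inl rfl⟩ hev).1 i rfl
  · exact (hstep t _ ht ⟨i, .inr rfl⟩ hev).2 i rfl
  · obtain ⟨Q, hQ, hlen, hle, hx, hsol⟩ := (hinv t).2.2
    obtain ⟨s, hex, hs1, hs2, hs3⟩ := exec_report (alg := alg) (A := 7) (M := n * cap) (mem t)
      (startState π (mem t) t none) rfl hQ
    obtain ⟨hsolQ, hrad⟩ := halg Q
    refine ⟨_, _, _, Q.length, ⟨s, hex, hs1, hs2, hs3⟩, hsol _ _ hsolQ, ?_, hlen, ?_⟩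
    -- The radius is at most `c * opt Q + ε * opt P ≤ (c + ε) * opt P`, where `Q` is the stored
    -- multiset and `P` the window, and `ε ≤ ε * c`.
    · have h1 := opt_mono (z := π.z) hk hle
      have h2 := opt_nonneg (k := π.k) (z := π.z) (S.window π.W t)
      have h3 := mul_le_mul_of_nonneg_left h1 (zero_le_one.trans hc)
      have h4 := mul_le_mul_of_nonneg_left hc (mul_nonneg hε.le h2)
      linarith
    · push_cast
      linarith [hT Q]

end Sketch

end SlidingKCenter

/-! ### The main theorem: constants and bounds -/

open SlidingKCenter in
theorem theorem3 (d : ℝ) (hd : 0 ≤ d) :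
    ∃ (G : SketchAlg) (K : ℝ),
      ∀ (X : Type u) [MetricSpace X], DoublingDimLE X d →
      ∀ π : Params, 1 ≤ π.k → 0 < π.ε → π.ε < 1 → 0 < π.W → 0 < π.Δmin → π.Δmin ≤ π.Δmax →
      ∃ A M : ℕ,
        ((3 * (A * M) : ℕ) : ℝ) ≤
          K * (π.k * (π.z + 1) / π.ε ^ d) * (1 + Real.logb 2 (π.Δmax / π.Δmin)) ∧
        ∀ (alg : StaticAlg X) (c : ℝ) (T : ℕ → ℝ), 1 ≤ c →
          alg.IsApprox π.k π.z c → alg.RunsIn T →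
        ∀ S : PointStream X, S.DistinctTimes π.W → S.DistBounds π.Δmin π.Δmax →
        ∃ mem : ℝ → Memory X,
          IsRun alg A M G π S
            (K * (π.k * (π.z + 1) / π.ε ^ d) ^ 3 * (1 + Real.logb 2 (π.Δmax / π.Δmin)))
            (K * (1 + Real.logb 2 (π.Δmax / π.Δmin))) mem ∧
          ∀ t : ℝ, ∃ (C : List X) (r : ℝ) (n m : ℕ),
            Reports alg A M G π (mem t) t C r n ∧
            IsSolution π.k π.z (S.window π.W t) C r ∧
            r ≤ (1 + π.ε) * c * opt π.k π.z (S.window π.W t) ∧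
            (m : ℝ) ≤ K * (π.k * (π.z + 1) / π.ε ^ d) ∧
            (n : ℝ) ≤ T m + K := by
  set B := ⌊(2 : ℝ) ^ d⌋₊ with hB
  -- The capacity is at most `c₀ * q`: `20 ^ d` comes from `B ^ J ≤ 20 ^ d / ε ^ d`, and `1` from
  -- the summand `z`.
  set c₀ : ℝ := 20 ^ d + 1 with hc₀
  have hc₀1 : 1 ≤ c₀ := by
    have : (0 : ℝ) < 20 ^ d := by positivity
    linarith
  -- The program and the constant depend on `d` only. The term with `B + 1` pays for computing the
  -- capacity, the one with `c₀ + 1` for the storage and for scanning the levels.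
  refine ⟨sketchAlg B, 2000 * (B + 1) + 700 * (c₀ + 1) + 1000, ?_⟩
  set K : ℝ := 2000 * (B + 1) + 700 * (c₀ + 1) + 1000 with hK
  intro X _ hX π hk hε hε1 hW hΔ hΔ'
  obtain ⟨J, hJ, hJ', hJ20⟩ := exists_powCount B hε hε1
  obtain ⟨n, hn0, hn, hn', hnle⟩ := exists_levelCount hΔ hΔ'
  have hεd : 0 < π.ε ^ d := Real.rpow_pos_of_pos hε d
  have hεd1 : π.ε ^ d ≤ 1 := Real.rpow_le_one hε.le hε1.le hd
  set L : ℝ := 1 + Real.logb 2 (π.Δmax / π.Δmin) with hL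
  have hL1 : 1 ≤ L := by
    have := Real.logb_nonneg one_lt_two ((one_le_div hΔ).2 hΔ')
    linarith
  set q : ℝ := π.k * (π.z + 1) / π.ε ^ d with hq
  have hk1 : (1 : ℝ) ≤ π.k := by exact_mod_cast hk
  have hz0 : (0 : ℝ) ≤ π.z := by positivity
  have hkz : (π.z : ℝ) + 1 ≤ π.k * (π.z + 1) := by nlinarith
  have hkzq : (π.k : ℝ) * (π.z + 1) ≤ q := by
    rw [hq, le_div_iff₀ hεd]
    nlinarith
  have hq1 : 1 ≤ q := by linarith
  have hJq : (J : ℝ) ≤ 20 * q := by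
    refine (powCount_le hε hε1 (fun j hj => (hJ j hj).1) hJ20).trans ?_
    rw [hq, ← mul_div_assoc]
    gcongr
    linarith
  set cap := π.k * B ^ J * (π.z + 1) + π.z with hcap
  have hcapq : (cap : ℝ) ≤ c₀ * q := by
    have h1 := floor_pow_le hd hε hJ20
    have h2 : (π.k : ℝ) * (π.z + 1) * (B : ℝ) ^ J ≤ 20 ^ d * q := by
      refine (mul_le_mul_of_nonneg_left h1 (by positivity)).trans (le_of_eq ?_)
      rw [hq]
      ring
    rw [hcap]
    push_cast
    linarith
  have hnL : (n : ℝ) ≤ 3 * L := hnle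
  have hqL : q ≤ q * L := by nlinarith
  have hLq : L ≤ q * L := by nlinarith
  have hncap : (n : ℝ) * (cap + 1) ≤ 3 * (c₀ + 1) * (q * L) := by
    have h1 : (cap : ℝ) + 1 ≤ (c₀ + 1) * q := by linarith
    calc (n : ℝ) * (cap + 1) ≤ 3 * L * ((c₀ + 1) * q) := by gcongr
      _ = 3 * (c₀ + 1) * (q * L) := by ring
  have hB0 : (0 : ℝ) ≤ B := by positivity
  refine ⟨7, n * cap, ?_, fun alg c T hc halg hT S hS hSd => ?_⟩
  · push_cast
    have h1 : (n : ℝ) * cap ≤ n * (cap + 1) := by gcongr; linarith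
    have h2 : 0 ≤ (2000 * ((B : ℝ) + 1) + 1000) * (q * L) := by positivity
    have h3 : 0 ≤ (c₀ + 1) * (q * L) := by positivity
    rw [mul_assoc, hK]
    linarith
  · have htArr : ((100 * (J * (B + 1) + π.z + 1) +
        (200 * (n * (cap + 1) + 1) + 100 * (n + 1)) : ℕ) : ℝ) ≤ K * q ^ 3 * L := by
      push_cast
      have h1 : (J : ℝ) * (B + 1) ≤ 20 * (B + 1) * (q * L) := by
        calc (J : ℝ) * (B + 1) ≤ 20 * q * (B + 1) := by gcongr
          _ = 20 * (B + 1) * q := by ring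
          _ ≤ 20 * (B + 1) * (q * L) := by gcongr
      have h2 : K * (q * L) ≤ K * q ^ 3 * L := by
        have : q ≤ q ^ 3 := le_self_pow₀ hq1 (by norm_num)
        rw [mul_assoc]
        gcongr
      have h3 : 0 ≤ (c₀ + 1) * (q * L) := by positivity
      rw [hK] at h2 ⊢
      linarith
    have htDep : ((100 * (n + 1) : ℕ) : ℝ) ≤ K * L := by
      push_cast
      have h2 : 0 ≤ (2000 * ((B : ℝ) + 1) + 700 * (c₀ + 1)) * L := by positivity
      rw [hK]
      linarith
    obtain ⟨mem, hrun, hrep⟩ := exists_sketch hd hX hk hε hε1 hW hΔ hΔ' hn0 hn hn' hB hJ hJ' hcap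
      hS hSd hc halg hT htArr htDep
    refine ⟨mem, hrun, fun t => ?_⟩
    obtain ⟨C, r, n', m, h1, h2, h3, h4, h5⟩ := hrep t
    refine ⟨C, r, n', m, h1, h2, h3, ?_, ?_⟩
    · have h6 : (m : ℝ) ≤ cap := by exact_mod_cast h4
      have h7 : 0 ≤ (2000 * ((B : ℝ) + 1) + 699 * c₀ + 700 + 1000) * q := by positivity
      rw [hK]
      linarith
    · have h6 : 11 ≤ K := by linarith
      linarith
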